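/- A \emph{matroid $k$-parity constraint} on a finite set $E$ ("edges") is given by a matroid $\mathcal M$ whose ground set ("vertices") is partitioned into sets $v(e)$, $e\in E$, of size at most $k$; a set $S\subseteq E$ is feasible if $\bigcup_{e\in S}v(e)$ is independent in $\mathcal M$. A function $f\colon 2^E\to\mathbb R_{\ge 0}$ is \emph{submodular} if $f(S\cup\{e\})-f(S)\ge f(T\cup\{e\})-f(T)$ for all $S\subseteq T\subseteq E$ and $e\in E\setminus T$. Algorithms are randomized, work in the real-RAM model with unit-cost steps (arithmetic and comparison of reals, drawing independent uniform numbers $\alpha\in(0,1]$, computing $2^{\alpha}$ for $\alpha\in[0,1]$ and $a\,2^{-\lceil\log_2 a-\log_2 b\rceil}$ for $a,b>0$), get the numbers $|E|$ and $k$ as input, and access the constraint only through an oracle that tells whether a set $S\subseteq E$ is feasible, and $f$ only through an oracle that returns $f(S)$. \textbf{Theorem 2.} There exist one randomized algorithm, a polynomial $p$ and a constant $C\ge 0$ such that the following holds for every $k\ge 1$, every finite set $E$, every matroid $k$-parity constraint on $E$ and every non-negative (not necessarily monotone) submodular function $f\colon 2^E\to\mathbb R_{\ge0}$. For every outcome of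 its random draws, the algorithm halts within $p(|E|)$ steps (a bound that does not depend on $k$) and outputs a feasible set $B\subseteq E$; and \[ f(S)\;\le\;\Bigl(\frac{2k\ln 2}{1+\ln 2}+C\,k^{2/3}\Bigr)\cdot\mathbb E[f(B)]\qquad\text{for every feasible } S\subseteq E . \] That is, the algorithm runs in $\mathrm{Poly}(|E|)$ time and has approximation ratio $\frac{2k\ln 2}{1+\ln 2}+O(k^{2/3})\le 0.819\,k+O(k^{2/3})$. -/

import Mathlib

open scoped ENNReal

/-!
## The problem

The ground set `E` of the constraint has `n` elements, labelled by `Fin n`.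
-/

/-- A set function is submodular if marginal contributions diminish. -/
def IsSubmodular {n : ℕ} (f : Finset (Fin n) → ℝ) : Prop :=
  ∀ S T : Finset (Fin n), S ⊆ T → ∀ e : Fin n, e ∉ T →
    f (insert e T) - f T ≤ f (insert e S) - f S

/-- `feas` is the family of feasible sets of a matroid `k`-parity constraint whose ground set (of
"edges") is `Fin n`: there is a matroid `M` whose ground set (of "vertices") is partitioned into
the sets `v e`, for `e : Fin n`, each of at most `k` vertices, and a set of edges is feasible iff
the union of its edges is independent in `M`.
(The vertex set is finite, being a union of `n` sets of size at most `k`, so nothing is lost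
by taking `V : Type`.) -/
def IsMatroidParity {n : ℕ} (k : ℕ) (feas : Finset (Fin n) → Prop) : Prop :=
  ∃ (V : Type) (M : Matroid V) (v : Fin n → Set V),
    (⋃ e, v e) = M.E ∧
    Pairwise (fun e e' => Disjoint (v e) (v e')) ∧
    (∀ e, (v e).encard ≤ k) ∧
    ∀ S : Finset (Fin n), feas S ↔ M.Indep (⋃ e ∈ S, v e)

/-!
## The machine model

A program is a finite term of a small imperative language, fixed once and for all (it does not
depend on the instance).  It manipulates counters, real numbers (real RAM model) and subsets of
the ground set; it accesses the constraint only through the feasibility oracle and the objective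
only through the value oracle, and it may draw independent uniform numbers from `(0, 1]`.  Every
step, in particular every oracle query, has cost one.
-/

/-- Elementary instructions. All arguments are register names: letters `i, j` name counters,
`a, b, r` name real registers, `S, T` name set registers. -/
inductive Instr : Type
  /-- counter `i` becomes the constant `c` -/
  | natConst (i c : ℕ)
  /-- counter `i` becomes a copy of counter `j` -/
  | natCopy (i j : ℕ)
  /-- counter `i` is incremented -/
  | natSucc (i : ℕ)
  /-- `r` becomes the value of counter `i` -/
  | realOfNat (r i : ℕ)
  | realAdd (r a b : ℕ)
  | realSub (r a b : ℕ)
  | realMul (r a b : ℕ)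
  | realDiv (r a b : ℕ)
  /-- `r` becomes `2 ^ a`, for `a` in `[0, 1]` -/
  | realExp (r a : ℕ)
  /-- `r` becomes `a * 2 ^ (-t)` with the integer `t = ⌈log₂ a - log₂ b⌉`, for `a, b > 0`: the
  largest number of this form, `t` an integer, that is at most `b` -/
  | realScale (r a b : ℕ)
  /-- value oracle: `r` becomes `f S` -/
  | value (r S : ℕ)
  /-- the element whose index is in counter `i` is added to `S` -/
  | setInsert (S i : ℕ)
  /-- the element whose index is in counter `i` is removed from `S` -/
  | setErase (S i : ℕ)
  /-- `S` becomes a copy of `T` -/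
  | setCopy (S T : ℕ)

/-- Tests used for branching. -/
inductive Test : Type
  | natLt (i j : ℕ)
  | realLt (a b : ℕ)
  /-- the element whose index is in counter `i` belongs to `S` -/
  | mem (i S : ℕ)
  /-- feasibility oracle: is `S` feasible? -/
  | feasible (S : ℕ)
  | not (t : Test)
  | and (t t' : Test)

/-- Programs. -/
inductive Prog : Type
  | instr (o : Instr)
  /-- real register `r` becomes a fresh uniformly random number from `(0, 1]` -/
  | sample (r : ℕ)
  | seq (c c' : Prog)
  | ite (t : Test) (c c' : Prog)
  | while (t : Test) (c : Prog)

/-- The memory of a program that runs on an instance with `n` elements. (A given program uses only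
finitely many of the registers.) -/
structure Memory (n : ℕ) : Type where
  /-- the counters -/
  nat : ℕ → ℕ
  /-- the real registers -/
  real : ℕ → ℝ
  /-- the set registers -/
  set : ℕ → Finset (Fin n)

/-- What a program gets: the oracles for the constraint and for the objective. -/
structure Oracles (n : ℕ) : Type where
  /-- the feasibility oracle -/
  feas : Finset (Fin n) → Prop
  /-- the value oracle -/
  f : Finset (Fin n) → ℝ

namespace Memory

variable {n : ℕ}

/-- Initially the first two counters hold `n` and `k`; all other registers are zero or empty. -/
def init (n k : ℕ) : Memory n where
  nat := fun i => if i = 0 then n else if i = 1 then k else 0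
  real := fun _ => 0
  set := fun _ => ∅

/-- Write counter `i`. -/
def setNat (s : Memory n) (i x : ℕ) : Memory n := { s with nat := Function.update s.nat i x }

/-- Write real register `r`. -/
def setReal (s : Memory n) (r : ℕ) (x : ℝ) : Memory n :=
  { s with real := Function.update s.real r x }

/-- Write set register `S`. -/
def setSet (s : Memory n) (S : ℕ) (X : Finset (Fin n)) : Memory n :=
  { s with set := Function.update s.set S X }

end Memory

/-- Effect of an instruction on the memory. An index that is not smaller than `n` names no element,
and `setInsert`, `setErase` do nothing then. -/
noncomputable def Instr.exec {n : ℕ} (O : Oracles n) (s : Memory n) : Instr → Memory n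
  | natConst i c => s.setNat i c
  | natCopy i j => s.setNat i (s.nat j)
  | natSucc i => s.setNat i (s.nat i + 1)
  | realOfNat r i => s.setReal r (s.nat i : ℝ)
  | realAdd r a b => s.setReal r (s.real a + s.real b)
  | realSub r a b => s.setReal r (s.real a - s.real b)
  | realMul r a b => s.setReal r (s.real a * s.real b)
  | realDiv r a b => s.setReal r (s.real a / s.real b)
  | realExp r a => s.setReal r ((2 : ℝ) ^ (max 0 (min 1 (s.real a))))
  | realScale r a b => s.setReal r
      (if 0 < s.real a ∧ 0 < s.real b then
        s.real a * (2 : ℝ) ^ (-⌈Real.logb 2 (s.real a) - Real.logb 2 (s.real b)⌉ : ℤ)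
      else 0)
  | value r S => s.setReal r (O.f (s.set S))
  | setInsert S i =>
      if h : s.nat i < n then s.setSet S (insert ⟨s.nat i, h⟩ (s.set S)) else s
  | setErase S i =>
      if h : s.nat i < n then s.setSet S ((s.set S).erase ⟨s.nat i, h⟩) else s
  | setCopy S T => s.setSet S (s.set T)

/-- Truth of a test. -/
def Test.Holds {n : ℕ} (O : Oracles n) (s : Memory n) : Test → Prop
  | natLt i j => s.nat i < s.nat j
  | realLt a b => s.real a < s.real b
  | mem i S => ∃ h : s.nat i < n, (⟨s.nat i, h⟩ : Fin n) ∈ s.set S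
  | feasible S => O.feas (s.set S)
  | not t => ¬ t.Holds O s
  | and t t' => t.Holds O s ∧ t'.Holds O s

/-- The tree of all possible outcomes of a randomized computation with a bounded number of steps:
it has halted with a result, it has run out of steps, or it draws a random number `u` from `(0, 1]`
and goes on with `next u`. -/
inductive Outcome (α : Type) : Type
  | done (a : α)
  | timeout
  | draw (next : ℝ → Outcome α)

namespace Outcome

variable {α : Type}

/-- For all possible values of the random draws, the computation halts within its number of steps,
with a result that satisfies `P`. -/
def Always (P : α → Prop) : Outcome α → Prop
  | done a => P a
  | timeout => False
  | draw next => ∀ u ∈ Set.Ioc (0 : ℝ) 1, (next u).Always P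

/-- The expected value of `g` at the result, where the draws are independent and uniform on
`(0, 1]` (a computation that runs out of steps contributes zero). -/
noncomputable def expect (g : α → ℝ≥0∞) : Outcome α → ℝ≥0∞
  | done a => g a
  | timeout => 0
  | draw next => ∫⁻ u in Set.Ioc (0 : ℝ) 1, (next u).expect g

end Outcome

open scoped Classical in
/-- `run O t K s`: execute for at most `t` steps the programs in the list `K`, one after the other,
from the memory `s`. Each instruction, each random draw, each evaluation of a branching or loop
condition, and each unfolding of a sequential composition is one step. -/
noncomputable def run {n : ℕ} (O : Oracles n) : ℕ → List Prog → Memory n → Outcome (Memory n)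
  | _, [], s => .done s
  | 0, _ :: _, _ => .timeout
  | t + 1, .instr o :: K, s => run O t K (o.exec O s)
  | t + 1, .sample r :: K, s => .draw fun u => run O t K (s.setReal r u)
  | t + 1, .seq c c' :: K, s => run O t (c :: c' :: K) s
  | t + 1, .ite b c c' :: K, s => run O t ((if b.Holds O s then c else c') :: K) s
  | t + 1, .while b c :: K, s => run O t (if b.Holds O s then c :: .while b c :: K else K) s

/-- Run the program `P` for at most `t` steps on the instance of the problem that is given by its
number `n` of elements, the number `k` and the two oracles. When the program halts, its output is
the set in set register `0`. -/
noncomputable def Prog.runOn {n : ℕ} (P : Prog) (k : ℕ) (feas : Finset (Fin n) → Prop)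
    (f : Finset (Fin n) → ℝ) (t : ℕ) : Outcome (Memory n) :=
  run ⟨feas, f⟩ t [P] (Memory.init n k)

/-- The output set. -/
def Memory.output {n : ℕ} (s : Memory n) : Finset (Fin n) := s.set 0

/-! The algorithm is deterministic. A run of local search keeps `l = 10000` disjoint feasible sets
and halves a threshold τ in each phase. At threshold τ it adds free edges, or replaces an edge added
in the current phase by two free edges, where each new edge must have marginal at least τ. Hence `m`
new edges raise the value of a solution by at least `τ * m`.

Charging for one solution: let `O` be feasible, and maintain a set `I` of vertices of `O` that
extends the solution independently. Adding `m` edges expels at most `k * m` vertices from `I`; each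
of them pays τ to its edge. An unpaid edge has marginal at most 2τ. If it loses two vertices, it is
paid in full. If it loses none, it could be added, so its marginal is at most τ and it waits for the
next phase. If it loses exactly one, it gets τ; the exchange argument `exists_exchange_two` and the
absence of swaps show that, after setting aside at most `m` edges of total value at most 2τm, its
marginal is at most τ. Edges taken by another solution are paid 2τ from the gain of that solution.
So payments of total `(k + O(l)) * F`, where `F` is the output value, cover the marginals of `O`
(`exists_payment_aux`).

The leading constant drops below one because each payment reaches a power of two, times the initial
threshold, that bounds the marginal. On the three grids shifted by `1`, `5 / 4` and `8 / 5`, the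
roundings of the same number cannot all be tight: they add up to at least 61/16 times that number
instead of 3 times (`shifted_powers_sum`). Three runs thus give a factor near 48/61, which leaves
room for the losses below 0.818 < 2 ln 2 / (1 + ln 2).

Without monotonicity, adding a solution to `O` may destroy value. Since the solutions are disjoint,
one of them costs at most the fraction `1 / l` of `f O` (`exists_union_ge`). This also makes the
marginals seen in the three runs nearly equal on average to the common numbers `orderedMarginal`, so
that the runs can be compared edge by edge. -/

/-! ### Rank of finite sets in a matroid -/

namespace Matroid

variable {V : Type} (M : Matroid V)

/-- The rank of a finite set, as a natural number. -/
noncomputable def finRk (X : Finset V) : ℕ := (M.eRk (X : Set V)).toNat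

theorem coe_finRk (X : Finset V) : (M.finRk X : ℕ∞) = M.eRk (X : Set V) := by
  refine ENat.natCast_toNat (ne_top_of_le_ne_top ?_ (M.eRk_le_encard _))
  simp

theorem finRk_mono {X Y : Finset V} (h : X ⊆ Y) : M.finRk X ≤ M.finRk Y := by
  have := M.eRk_mono (Finset.coe_subset.2 h)
  rwa [← M.coe_finRk, ← M.coe_finRk, Nat.cast_le] at this

variable {M}

theorem Indep.finRk_eq {X : Finset V} (h : M.Indep (X : Set V)) : M.finRk X = X.card := by
  have := h.eRk_eq_encard
  rwa [← M.coe_finRk, Set.encard_coe_eq_coe_finsetCard, Nat.cast_inj] at this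

theorem Indep.card_le_finRk {I X : Finset V} (h : M.Indep (I : Set V)) (hX : I ⊆ X) :
    I.card ≤ M.finRk X :=
  h.finRk_eq ▸ M.finRk_mono hX

theorem Indep.exists_finset_basis {I X : Finset V} (h : M.Indep (I : Set V)) (hX : I ⊆ X) :
    ∃ J : Finset V, I ⊆ J ∧ J ⊆ X ∧ M.Indep (J : Set V) ∧ J.card = M.finRk X := by
  obtain ⟨J, hJ, hIJ⟩ := h.subset_isBasis'_of_subset (Finset.coe_subset.2 hX)
  have hfin : J.Finite := X.finite_toSet.subset hJ.subset
  lift J to Finset V using hfin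
  refine ⟨J, by simpa using hIJ, by simpa using hJ.subset, hJ.indep, ?_⟩
  have := hJ.encard_eq_eRk
  rwa [← M.coe_finRk, Set.encard_coe_eq_coe_finsetCard, Nat.cast_inj] at this

variable [DecidableEq V]

theorem finRk_inter_add_finRk_union_le (X Y : Finset V) :
    M.finRk (X ∩ Y) + M.finRk (X ∪ Y) ≤ M.finRk X + M.finRk Y := by
  have := M.eRk_inter_add_eRk_union_le (X : Set V) Y
  rw [← Finset.coe_inter, ← Finset.coe_union] at this
  simp only [← M.coe_finRk] at this
  exact_mod_cast this

/-- If an independent set `Y ∪ X` lies in the span of an independent set `Y ∪ ⋃ a ∈ C, v a` and `X`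
has more elements than `C`, then some block `v a` can be exchanged for two elements of `X`. -/
theorem exists_exchange_two {ι : Type} [DecidableEq ι] {C : Finset ι} {v : ι → Finset V}
    (hv : ∀ a ∈ C, ∀ b ∈ C, a ≠ b → Disjoint (v a) (v b)) {X Y : Finset V}
    (hYC : Disjoint Y (C.biUnion v)) (hYX : Disjoint Y X)
    (hC : M.Indep (↑(Y ∪ C.biUnion v) : Set V)) (hX : M.Indep (↑(Y ∪ X) : Set V))
    (hspan : M.finRk (Y ∪ C.biUnion v ∪ X) = (Y ∪ C.biUnion v).card) (hcard : C.card < X.card) :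
    ∃ a ∈ C, ∃ x ∈ X, ∃ y ∈ X, x ≠ y ∧
      M.Indep (↑(Y ∪ (C.erase a).biUnion v ∪ {x, y}) : Set V) := by
  by_contra! hcon
  have hcardU : (Y ∪ C.biUnion v).card = Y.card + (C.biUnion v).card :=
    Finset.card_union_of_disjoint hYC
  -- Without the block of `a`, no two elements of `X` can be added together, so `X` raises the rank
  -- by at most one.
  have hone : ∀ a ∈ C, M.finRk (Y ∪ (C.erase a).biUnion v ∪ X) + (v a).card ≤
      Y.card + (C.biUnion v).card + 1 := by
    intro a ha
    have hsub : Y ∪ (C.erase a).biUnion v ⊆ Y ∪ C.biUnion v :=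
      Finset.union_subset_union_right (Finset.biUnion_subset_biUnion_of_subset_left _
        (Finset.erase_subset _ _))
    have hind : M.Indep (↑(Y ∪ (C.erase a).biUnion v) : Set V) :=
      hC.subset (Finset.coe_subset.2 hsub)
    obtain ⟨J, hJ1, hJ2, hJ3, hJ4⟩ := hind.exists_finset_basis
      (Finset.subset_union_left (s₂ := X))
    have hle : (J \ (Y ∪ (C.erase a).biUnion v)).card ≤ 1 := by
      rw [Finset.card_le_one]
      intro x hx y hy
      by_contra hne
      rw [Finset.mem_sdiff] at hx hy
      have hx' := (Finset.mem_union.1 (hJ2 hx.1)).resolve_left hx.2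
      have hy' := (Finset.mem_union.1 (hJ2 hy.1)).resolve_left hy.2
      refine hcon a ha x hx' y hy' hne (hJ3.subset (Finset.coe_subset.2 ?_))
      refine Finset.union_subset hJ1 ?_
      intro z hz
      rcases Finset.mem_insert.1 hz with rfl | hz
      · exact hx.1
      · rw [Finset.mem_singleton] at hz; exact hz ▸ hy.1
    have h1 := Finset.card_sdiff_add_card_eq_card hJ1
    have h2 : (Y ∪ (C.erase a).biUnion v).card ≤ Y.card + ((C.erase a).biUnion v).card :=
      Finset.card_union_le _ _
    have h3 : (C.biUnion v).card = (v a).card + ((C.erase a).biUnion v).card := by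
      conv_lhs => rw [← Finset.insert_erase ha]
      rw [Finset.biUnion_insert, Finset.card_union_of_disjoint]
      rw [Finset.disjoint_biUnion_right]
      intro b hb
      exact hv a ha b (Finset.mem_of_mem_erase hb) (Finset.ne_of_mem_erase hb).symm
    omega
  -- Rank submodularity combines the bounds for single blocks: the union of the two sets has full
  -- rank, so the deficits of the removed blocks add up.
  have hall : ∀ S ⊆ C, M.finRk (Y ∪ (C \ S).biUnion v ∪ X) + (S.biUnion v).card ≤
      Y.card + (C.biUnion v).card + S.card := by
    intro S
    induction S using Finset.induction_on with
    | empty =>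
      intro _
      simp only [Finset.sdiff_empty, Finset.biUnion_empty, Finset.card_empty, add_zero]
      omega
    | insert a S haS ih =>
      intro hS
      have haC : a ∈ C := hS (Finset.mem_insert_self _ _)
      have hSC : S ⊆ C := (Finset.subset_insert _ _).trans hS
      have h1 := ih hSC
      have h2 := hone a haC
      have h3 := M.finRk_inter_add_finRk_union_le (Y ∪ (C \ S).biUnion v ∪ X)
        (Y ∪ (C.erase a).biUnion v ∪ X)
      have h4 : M.finRk (Y ∪ (C \ insert a S).biUnion v ∪ X) ≤
          M.finRk ((Y ∪ (C \ S).biUnion v ∪ X) ∩ (Y ∪ (C.erase a).biUnion v ∪ X)) := by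
        refine M.finRk_mono (Finset.subset_inter ?_ ?_) <;>
        refine Finset.union_subset_union_left (Finset.union_subset_union_right
          (Finset.biUnion_subset_biUnion_of_subset_left _ ?_)) <;>
        intro z hz <;> simp only [Finset.mem_sdiff, Finset.mem_insert, Finset.mem_erase] at hz ⊢ <;>
        tauto
      have h5 : (Y ∪ C.biUnion v).card ≤
          M.finRk ((Y ∪ (C \ S).biUnion v ∪ X) ∪ (Y ∪ (C.erase a).biUnion v ∪ X)) := by
        refine hC.card_le_finRk ?_
        refine Finset.union_subset ?_ (Finset.biUnion_subset.2 fun b hb => ?_)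
        · intro z hz; simp [hz]
        · by_cases hba : b = a
          · have : v b ⊆ (C \ S).biUnion v :=
              Finset.subset_biUnion_of_mem v (by rw [hba]; simp [haC, haS])
            intro z hz
            have := this hz
            simp only [Finset.mem_union]; tauto
          · have : v b ⊆ (C.erase a).biUnion v :=
              Finset.subset_biUnion_of_mem v (Finset.mem_erase.2 ⟨hba, hb⟩)
            intro z hz
            have := this hz
            simp only [Finset.mem_union]; tauto
      have h6 : ((insert a S).biUnion v).card ≤ (v a).card + (S.biUnion v).card := by
        rw [Finset.biUnion_insert]; exact Finset.card_union_le _ _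
      rw [Finset.card_insert_of_notMem haS]
      omega
  -- With all blocks removed, `Y ∪ X` has rank at most `Y.card + C.card`, but it is independent and
  -- larger.
  have hfinal := hall C subset_rfl
  have h1 : (Y ∪ X).card ≤ M.finRk (Y ∪ (C \ C).biUnion v ∪ X) :=
    hX.card_le_finRk (by simp)
  rw [Finset.card_union_of_disjoint hYX] at h1
  omega

/-- After new blocks `A \ P` are added to an independent family `P` of blocks, all but at most
`|⋃ a ∈ A \ P, v a|` elements of a set `I` that extends `P` remain as an extension of `A`. -/
theorem exists_extension {n : ℕ} {v : Fin n → Finset V} {P A : Finset (Fin n)} {I : Finset V}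
    (hPA : P ⊆ A) (hdisj : Disjoint (P.biUnion v) I)
    (hPI : M.Indep (↑(P.biUnion v ∪ I) : Set V)) (hA : M.Indep (↑(A.biUnion v) : Set V)) :
    ∃ I' ⊆ I, Disjoint (A.biUnion v) I' ∧ M.Indep (↑(A.biUnion v ∪ I') : Set V) ∧
      M.finRk (A.biUnion v ∪ I) = (A.biUnion v ∪ I').card ∧
      (I \ I').card ≤ ((A \ P).biUnion v).card := by
  obtain ⟨J, hJ1, hJ2, hJ3, hJ4⟩ := hA.exists_finset_basis (Finset.subset_union_left (s₂ := I))
  have hJ : A.biUnion v ∪ J \ A.biUnion v = J := Finset.union_sdiff_of_subset hJ1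
  have hsub : J \ A.biUnion v ⊆ I := fun x hx => by
    rw [Finset.mem_sdiff] at hx
    exact (Finset.mem_union.1 (hJ2 hx.1)).resolve_left hx.2
  refine ⟨J \ A.biUnion v, hsub, Finset.disjoint_sdiff, by rwa [hJ], by rw [hJ, hJ4], ?_⟩
  have h1 : (P.biUnion v ∪ I).card ≤ M.finRk (A.biUnion v ∪ I) :=
    hPI.card_le_finRk (Finset.union_subset_union_left
      (Finset.biUnion_subset_biUnion_of_subset_left _ hPA))
  rw [Finset.card_union_of_disjoint hdisj] at h1
  have h2 := Finset.card_sdiff_add_card_eq_card hJ1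
  have h3 := Finset.card_sdiff_add_card_eq_card hsub
  have h4 : (A.biUnion v).card ≤ (P.biUnion v).card + ((A \ P).biUnion v).card := by
    conv_lhs => rw [← Finset.union_sdiff_of_subset hPA]
    rw [Finset.union_biUnion]
    exact Finset.card_union_le _ _
  omega

/-- If no block of `A \ P` can be exchanged for two blocks of `U`, and each block of `U` loses
exactly one element on passing from `I` to `I'`, then `U` has at most as many blocks as `A \ P`. -/
theorem card_le_of_no_exchange {n : ℕ} {v : Fin n → Finset V}
    (hv : Pairwise fun a b => Disjoint (v a) (v b)) {P A U : Finset (Fin n)} {I I' : Finset V}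
    (hPA : P ⊆ A) (hdisj : Disjoint (P.biUnion v) I) (hPI : M.Indep (↑(P.biUnion v ∪ I) : Set V))
    (hI : I' ⊆ I) (hdisj' : Disjoint (A.biUnion v) I')
    (hAI : M.Indep (↑(A.biUnion v ∪ I') : Set V))
    (hspan : M.finRk (A.biUnion v ∪ I) = (A.biUnion v ∪ I').card)
    (hU : ∀ u ∈ U, v u ⊆ I) (hU1 : ∀ u ∈ U, (v u ∩ (I \ I')).card = 1)
    (hno : ∀ a ∈ A \ P, ∀ b ∈ U, ∀ c ∈ U, b ≠ c →
      ¬ M.Indep (↑((insert c (insert b (A.erase a))).biUnion v) : Set V)) :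
    U.card ≤ (A \ P).card := by
  by_contra! hlt
  have hX : (U.biUnion fun u => v u ∩ (I \ I')).card = U.card := by
    rw [Finset.card_biUnion, Finset.sum_congr rfl hU1]
    · simp
    · intro a _ b _ hab
      exact (hv hab).mono Finset.inter_subset_left Finset.inter_subset_left
  have hXI : (U.biUnion fun u => v u ∩ (I \ I')) ⊆ I \ I' :=
    Finset.biUnion_subset.2 fun u _ => Finset.inter_subset_right
  have heq : P.biUnion v ∪ I' ∪ (A \ P).biUnion v = A.biUnion v ∪ I' := by
    conv_rhs => rw [← Finset.union_sdiff_of_subset hPA]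
    rw [Finset.union_biUnion, Finset.union_right_comm]
  -- `X` consists of the lost vertices, one for each block of `U`. All other vertices of these
  -- blocks lie in `I'`, so restoring two lost vertices restores two whole blocks.
  obtain ⟨a, ha, x, hx, y, hy, hxy, hind⟩ := M.exists_exchange_two (C := A \ P) (v := v)
    (X := U.biUnion fun u => v u ∩ (I \ I')) (Y := P.biUnion v ∪ I')
    (fun a _ b _ hab => hv hab)
    (by
      rw [Finset.disjoint_union_left]
      refine ⟨?_, (hdisj'.mono_left (Finset.biUnion_subset_biUnion_of_subset_left _
        Finset.sdiff_subset)).symm⟩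
      rw [Finset.disjoint_biUnion_left]
      intro b hb
      rw [Finset.disjoint_biUnion_right]
      intro c hc
      refine hv ?_
      rintro rfl
      exact (Finset.mem_sdiff.1 hc).2 hb)
    (by
      rw [Finset.disjoint_union_left]
      exact ⟨hdisj.mono_right (hXI.trans Finset.sdiff_subset),
        Finset.disjoint_sdiff.mono_right hXI⟩)
    (by rwa [heq])
    (hPI.subset (Finset.coe_subset.2 (by
      rw [Finset.union_assoc]
      exact Finset.union_subset_union_right (Finset.union_subset hI
        (hXI.trans Finset.sdiff_subset)))))
    (by
      rw [heq]
      refine le_antisymm ?_ (hAI.card_le_finRk Finset.subset_union_left)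
      rw [← hspan]
      refine M.finRk_mono ?_
      rw [Finset.union_assoc]
      exact Finset.union_subset_union_right (Finset.union_subset hI
        (hXI.trans Finset.sdiff_subset)))
    (by rwa [hX])
  obtain ⟨b, hb, hxb⟩ := Finset.mem_biUnion.1 hx
  obtain ⟨c, hc, hyc⟩ := Finset.mem_biUnion.1 hy
  have hbc : b ≠ c := by
    rintro rfl
    exact hxy (Finset.card_le_one.1 (hU1 b hb).le x hxb y hyc)
  have hsingle : ∀ u ∈ U, ∀ z ∈ v u ∩ (I \ I'), v u ⊆ I' ∪ {z} := by
    intro u hu z hz w hw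
    by_cases hwI : w ∈ I'
    · exact Finset.mem_union_left _ hwI
    · refine Finset.mem_union_right _ (Finset.mem_singleton.2 ?_)
      exact Finset.card_le_one.1 (hU1 u hu).le w
        (Finset.mem_inter.2 ⟨hw, Finset.mem_sdiff.2 ⟨hU u hu hw, hwI⟩⟩) z hz
  refine hno a ha b hb c hc hbc (hind.subset (Finset.coe_subset.2 ?_))
  refine Finset.biUnion_subset.2 fun e he => ?_
  rcases Finset.mem_insert.1 he with rfl | he
  · intro z hz
    have := hsingle _ hc y hyc hz
    simp only [Finset.mem_union, Finset.mem_singleton, Finset.mem_insert] at this ⊢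
    tauto
  rcases Finset.mem_insert.1 he with rfl | he
  · intro z hz
    have := hsingle _ hb x hxb hz
    simp only [Finset.mem_union, Finset.mem_singleton, Finset.mem_insert] at this ⊢
    tauto
  · rw [Finset.mem_erase] at he
    by_cases heP : e ∈ P
    · have := Finset.subset_biUnion_of_mem v heP
      intro z hz
      have := this hz
      simp only [Finset.mem_union]; tauto
    · have := Finset.subset_biUnion_of_mem v (s := (A \ P).erase a)
        (Finset.mem_erase.2 ⟨he.1, Finset.mem_sdiff.2 ⟨he.2, heP⟩⟩)
      intro z hz
      have := this hz
      simp only [Finset.mem_union]; tauto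

end Matroid

/-! ### Submodular functions -/

namespace IsSubmodular

variable {n : ℕ} {f : Finset (Fin n) → ℝ} (hf : IsSubmodular f)
include hf

theorem le_insert_of_subset {S T : Finset (Fin n)} (hST : S ⊆ T) {e : Fin n} (he : e ∉ T) {c : ℝ}
    (h : f T + c ≤ f (insert e T)) : f S + c ≤ f (insert e S) := by
  have := hf S T hST e he
  linarith

/-- Since `c` is non-negative, the upper bound also survives when `e` already lies in the larger
set. -/
theorem insert_le_of_subset {S T : Finset (Fin n)} (hST : S ⊆ T) {e : Fin n} {c : ℝ} (hc : 0 ≤ c)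
    (h : f (insert e S) ≤ f S + c) : f (insert e T) ≤ f T + c := by
  by_cases he : e ∈ T
  · rw [Finset.insert_eq_of_mem he]; linarith
  · have := hf S T hST e he
    linarith

theorem union_le_add_card {A X B : Finset (Fin n)} (hAX : A ⊆ X) {c : ℝ} (hc : 0 ≤ c)
    (h : ∀ b ∈ B, f (insert b A) ≤ f A + c) : f (X ∪ B) ≤ f X + c * B.card := by
  induction B using Finset.induction_on with
  | empty => simp
  | insert b B hb ih =>
    have h1 := ih fun x hx => h x (Finset.mem_insert_of_mem hx)
    have h2 := hf.insert_le_of_subset (hAX.trans (Finset.subset_union_left (s₂ := B))) hc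
      (h b (Finset.mem_insert_self _ _))
    rw [Finset.union_insert, Finset.card_insert_of_notMem hb]
    push_cast
    linarith

theorem union_add_inter_le (S T : Finset (Fin n)) : f (S ∪ T) + f (S ∩ T) ≤ f S + f T := by
  have key : ∀ B : Finset (Fin n), Disjoint B S → ∀ A ⊆ S, f (S ∪ B) + f A ≤ f S + f (A ∪ B) := by
    intro B
    induction B using Finset.induction_on with
    | empty => intro _ A _; simp
    | insert b B hb ih =>
      intro hB A hA
      rw [Finset.disjoint_insert_left] at hB
      have h1 := ih hB.2 A hA
      have h2 := hf (A ∪ B) (S ∪ B) (Finset.union_subset_union_left hA) b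
        (by simp [hB.1, hb])
      rw [Finset.union_insert, Finset.union_insert]
      linarith
  have := key (T \ S) Finset.sdiff_disjoint (S ∩ T) Finset.inter_subset_left
  have h2 : S ∩ T ∪ T \ S = T := by
    rw [Finset.inter_comm, Finset.union_comm, Finset.sdiff_union_inter]
  rwa [Finset.union_sdiff_self_eq_union, h2] at this

/-- Disjointness makes `O ∪ σ j` meet the union of the earlier sets exactly in `O`, so each step of
merging by submodularity releases one copy of `f O`. -/
theorem sum_union_ge {l : ℕ} {σ : Fin l → Finset (Fin n)}
    (hσ : Pairwise fun i j => Disjoint (σ i) (σ j)) (O : Finset (Fin n)) (J : Finset (Fin l)) :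
    J.card * f O - f O + f (O ∪ J.biUnion σ) ≤ ∑ j ∈ J, f (O ∪ σ j) := by
  induction J using Finset.induction_on with
  | empty => simp
  | insert j J hj ih =>
    rw [Finset.sum_insert hj, Finset.card_insert_of_notMem hj, Finset.biUnion_insert]
    have h1 := hf.union_add_inter_le (O ∪ σ j) (O ∪ J.biUnion σ)
    have h2 : (O ∪ σ j) ∩ (O ∪ J.biUnion σ) = O := by
      rw [← Finset.union_inter_distrib_left]
      have : σ j ∩ J.biUnion σ = ∅ := by
        rw [← Finset.disjoint_iff_inter_eq_empty, Finset.disjoint_biUnion_right]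
        intro i hi
        exact hσ fun h => hj (h ▸ hi)
      rw [this, Finset.union_empty]
    have h3 : O ∪ σ j ∪ (O ∪ J.biUnion σ) = O ∪ (σ j ∪ J.biUnion σ) := by
      ext; simp only [Finset.mem_union]; tauto
    rw [h2, h3] at h1
    push_cast
    linarith

/-- Averaging over `j`: the total loss is at most one copy of `f O`, because `f` is non-negative on
the union of everything. -/
theorem exists_union_ge (hf0 : ∀ S, 0 ≤ f S) {l : ℕ} (hl : 0 < l) {σ : Fin l → Finset (Fin n)}
    (hσ : Pairwise fun i j => Disjoint (σ i) (σ j)) (O : Finset (Fin n)) :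
    ∃ j, (1 - 1 / (l : ℝ)) * f O ≤ f (O ∪ σ j) := by
  by_contra! h
  have h1 := hf.sum_union_ge hσ O Finset.univ
  have : Nonempty (Fin l) := ⟨⟨0, hl⟩⟩
  have h2 : ∑ j, f (O ∪ σ j) < ∑ _j : Fin l, (1 - 1 / (l : ℝ)) * f O :=
    Finset.sum_lt_sum_of_nonempty Finset.univ_nonempty fun j _ => h j
  rw [Finset.sum_const, Finset.card_univ, Fintype.card_fin, nsmul_eq_mul] at h2
  rw [Finset.card_univ, Fintype.card_fin] at h1
  have hl' : (l : ℝ) ≠ 0 := by positivity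
  have h3 : (l : ℝ) * ((1 - 1 / (l : ℝ)) * f O) = l * f O - f O := by field_simp
  have := hf0 (O ∪ Finset.univ.biUnion σ)
  linarith

omit hf in
theorem _root_.sum_marginals_eq (f : Finset (Fin n) → ℝ) (Z O : Finset (Fin n)) :
    ∑ o ∈ O, (f (insert o (Z ∪ O.filter (· < o))) - f (Z ∪ O.filter (· < o))) =
      f (Z ∪ O) - f Z := by
  induction O using Finset.induction_on_max with
  | empty => simp
  | insert a s hs ih =>
    have ha : a ∉ s := fun h => lt_irrefl _ (hs a h)
    rw [Finset.sum_insert ha]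
    have h1 : (insert a s).filter (· < a) = s := by
      rw [Finset.filter_insert, if_neg (lt_irrefl _), Finset.filter_true_of_mem hs]
    have h2 : ∀ o ∈ s, (insert a s).filter (· < o) = s.filter (· < o) := by
      intro o ho
      rw [Finset.filter_insert, if_neg (hs o ho).not_gt]
    rw [Finset.sum_congr rfl fun o ho => by rw [h2 o ho], ih, h1, Finset.union_insert]
    ring

end IsSubmodular

/-! ### Sets with large successive marginals -/

/-- `A` arises from `P` by adding elements one by one, each with marginal value at least `τ`. -/
inductive SteepExtension {n : ℕ} (f : Finset (Fin n) → ℝ) (τ : ℝ) (P : Finset (Fin n)) :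
    Finset (Fin n) → Prop
  | self : SteepExtension f τ P P
  | step {A : Finset (Fin n)} {e : Fin n} (hA : SteepExtension f τ P A) (he : e ∉ A)
      (h : f A + τ ≤ f (insert e A)) : SteepExtension f τ P (insert e A)

namespace SteepExtension

variable {n : ℕ} {f : Finset (Fin n) → ℝ} {τ : ℝ} {P A : Finset (Fin n)}

theorem subset (h : SteepExtension f τ P A) : P ⊆ A := by
  induction h with
  | self => exact subset_rfl
  | step _ _ _ ih => exact ih.trans (Finset.subset_insert _ _)

theorem add_card_le (h : SteepExtension f τ P A) : f P + τ * (A \ P).card ≤ f A := by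
  induction h with
  | self => simp
  | @step A e hA he h ih =>
    rw [Finset.insert_sdiff_of_notMem _ fun h => he (hA.subset h), Finset.card_insert_of_notMem
      fun h => he (Finset.mem_sdiff.1 h).1]
    push_cast
    linarith

/-- Skipping one addition can only increase the marginals of the later ones. This is what lets swaps
preserve steepness. -/
theorem erase (hf : IsSubmodular f) (h : SteepExtension f τ P A) {a : Fin n} (ha : a ∉ P) :
    SteepExtension f τ P (A.erase a) := by
  induction h with
  | self => rw [Finset.erase_eq_of_notMem ha]; exact .self
  | @step A e hA he h ih =>
    by_cases hea : e = a
    · subst hea; rwa [Finset.erase_insert he]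
    · rw [Finset.erase_insert_of_ne hea]
      exact ih.step (fun h => he (Finset.mem_of_mem_erase h))
        (hf.le_insert_of_subset (Finset.erase_subset _ _) he h)

theorem marginal (hf : IsSubmodular f) (h : SteepExtension f τ P A) {b : Fin n} (hb : b ∈ A)
    (hbP : b ∉ P) : f P + τ ≤ f (insert b P) := by
  induction h with
  | self => exact absurd hb hbP
  | @step A e hA he h ih =>
    rcases Finset.mem_insert.1 hb with rfl | hb
    · exact hf.le_insert_of_subset hA.subset he h
    · exact ih hb

/-- The order of the two elements is the one in which they were added to `A`, hence the disjunction.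
-/
theorem marginal_pair (hf : IsSubmodular f) (h : SteepExtension f τ P A) {b c : Fin n} (hb : b ∈ A)
    (hbP : b ∉ P) (hc : c ∈ A) (hcP : c ∉ P) (hbc : b ≠ c) :
    (f P + τ ≤ f (insert b P) ∧ f (insert b P) + τ ≤ f (insert c (insert b P))) ∨
      (f P + τ ≤ f (insert c P) ∧ f (insert c P) + τ ≤ f (insert b (insert c P))) := by
  induction h with
  | self => exact absurd hb hbP
  | @step A e hA he h ih =>
    rcases Finset.mem_insert.1 hb with rfl | hbA
    · have hcA := (Finset.mem_insert.1 hc).resolve_left hbc.symm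
      exact .inr ⟨hA.marginal hf hcA hcP,
        hf.le_insert_of_subset (Finset.insert_subset hcA hA.subset) he h⟩
    · rcases Finset.mem_insert.1 hc with rfl | hcA
      · exact .inl ⟨hA.marginal hf hbA hbP,
          hf.le_insert_of_subset (Finset.insert_subset hbA hA.subset) he h⟩
      · exact ih hbA hcA

end SteepExtension

/-! ### Phases of the local search -/

section Moves

variable {n l : ℕ} (feas : Finset (Fin n) → Prop) (f : Finset (Fin n) → ℝ) (τ : ℝ)
  (P σ : Fin l → Finset (Fin n))

/-- No solution contains `b`. -/
def IsFree (b : Fin n) : Prop := ∀ j, b ∉ σ j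

/-- The free element `b` can be added to the `j`-th solution. -/
def CanAdd (j : Fin l) (b : Fin n) : Prop :=
  IsFree σ b ∧ feas (insert b (σ j)) ∧ f (σ j) + τ ≤ f (insert b (σ j))

/-- In the `j`-th solution, the element `a`, which is not in `P j`, can be replaced by the free
elements `b` and `c`. -/
def CanSwap (j : Fin l) (a b c : Fin n) : Prop :=
  a ∈ σ j ∧ a ∉ P j ∧ IsFree σ b ∧ IsFree σ c ∧ b ≠ c ∧
    feas (insert c (insert b ((σ j).erase a))) ∧
    f ((σ j).erase a) + τ ≤ f (insert b ((σ j).erase a)) ∧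
    f (insert b ((σ j).erase a)) + τ ≤ f (insert c (insert b ((σ j).erase a)))

/-- `σ'` is the result of a phase of local search with threshold `τ` that starts with `P`. -/
structure IsPhase : Prop where
  disjoint : Pairwise fun i j => Disjoint (σ i) (σ j)
  feasible : ∀ j, feas (σ j)
  dense : ∀ j, SteepExtension f τ (P j) (σ j)
  not_canAdd : ∀ j b, ¬ CanAdd feas f τ σ j b
  not_canSwap : ∀ j a b c, ¬ CanSwap feas f τ P σ j a b c

end Moves

/-- A matroid parity constraint, with finite sets of vertices. -/
structure ParityRep {n : ℕ} (k : ℕ) (feas : Finset (Fin n) → Prop) {V : Type} [DecidableEq V]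
    (M : Matroid V) (v : Fin n → Finset V) : Prop where
  disjoint : Pairwise fun a b => Disjoint (v a) (v b)
  card_le : ∀ e, (v e).card ≤ k
  feas_iff : ∀ S, feas S ↔ M.Indep (↑(S.biUnion v) : Set V)

open scoped Classical in
theorem IsMatroidParity.exists_rep {n k : ℕ} {feas : Finset (Fin n) → Prop}
    (h : IsMatroidParity k feas) :
    ∃ (V : Type) (M : Matroid V) (v : Fin n → Finset V), ParityRep k feas M v := by
  obtain ⟨V, M, v, -, hdisj, hcard, hfeas⟩ := h
  have hfin : ∀ e, (v e).Finite := fun e =>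
    Set.finite_of_encard_le_coe (hcard e)
  refine ⟨V, M, fun e => (hfin e).toFinset, ⟨?_, ?_, ?_⟩⟩
  · intro a b hab
    rw [← Finset.disjoint_coe]
    simpa using hdisj hab
  · intro e
    have := hcard e
    rw [(hfin e).encard_eq_coe_toFinset_card] at this
    exact_mod_cast this
  · intro S
    rw [hfeas]
    simp

section Phase

variable {n l k : ℕ} {feas : Finset (Fin n) → Prop} {f : Finset (Fin n) → ℝ} {τ : ℝ}
  {P σ : Fin l → Finset (Fin n)} {V : Type} [DecidableEq V] {M : Matroid V}
  {v : Fin n → Finset V}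

theorem ParityRep.card_biUnion_le (h : ParityRep k feas M v) (S : Finset (Fin n)) :
    (S.biUnion v).card ≤ k * S.card := by
  rw [mul_comm]
  exact Finset.card_biUnion_le_card_mul _ _ _ fun e _ => h.card_le e

/-- What a phase does to a set `O` of edges whose vertices in `I` extend the `j`-th solution. -/
theorem IsPhase.exists_extension (h : IsPhase feas f τ P σ) (hrep : ParityRep k feas M v)
    (hf : IsSubmodular f) (j : Fin l) (O : Finset (Fin n)) {I : Finset V}
    (hdisj : Disjoint ((P j).biUnion v) I) (hI : M.Indep (↑((P j).biUnion v ∪ I) : Set V)) :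
    ∃ I' ⊆ I, ∃ B ⊆ O, Disjoint ((σ j).biUnion v) I' ∧
      M.Indep (↑((σ j).biUnion v ∪ I') : Set V) ∧
      (I \ I').card ≤ k * (σ j \ P j).card ∧ B.card ≤ (σ j \ P j).card ∧
      (∀ b ∈ B, v b ⊆ I ∧ IsFree σ b) ∧
      ∀ o ∈ O, v o ⊆ I → IsFree σ o →
        (v o ⊆ I' ∧ f (insert o (σ j)) ≤ f (σ j) + τ) ∨ o ∈ B ∨ 2 ≤ (v o ∩ (I \ I')).card ∨
          (1 ≤ (v o ∩ (I \ I')).card ∧ f (insert o (σ j ∪ B)) ≤ f (σ j ∪ B) + τ) := by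
  classical
  have hPσ := (h.dense j).subset
  obtain ⟨I', hI', hdisj', hind, hspan, hcard⟩ :=
    M.exists_extension hPσ hdisj hI ((hrep.feas_iff _).1 (h.feasible j))
  -- The critical edges: they lose one vertex, which pays only τ, while their marginal may exceed τ.
  set U := O.filter fun o => v o ⊆ I ∧ IsFree σ o ∧ (v o ∩ (I \ I')).card = 1 with hUdef
  -- A maximum steep family of critical edges. By maximality every other critical edge has marginal
  -- less than τ over `σ j ∪ B`, and since no swap is possible the exchange argument bounds
  -- `B.card`.
  obtain ⟨B, hB, hBmax⟩ := Finset.exists_max_image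
    (U.powerset.filter fun B => SteepExtension f τ (σ j) (σ j ∪ B)) Finset.card
    ⟨∅, by simpa using SteepExtension.self⟩
  rw [Finset.mem_filter, Finset.mem_powerset] at hB
  have hBU : ∀ b ∈ B, b ∈ O ∧ v b ⊆ I ∧ IsFree σ b ∧ (v b ∩ (I \ I')).card = 1 :=
    fun b hb => Finset.mem_filter.1 (hB.1 hb)
  have hswap : ∀ a ∈ σ j \ P j, ∀ b ∈ B, ∀ c ∈ B, b ≠ c → f (σ j) + τ ≤ f (insert b (σ j)) →
      f (insert b (σ j)) + τ ≤ f (insert c (insert b (σ j))) →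
      ¬ M.Indep (↑((insert c (insert b ((σ j).erase a))).biUnion v) : Set V) := by
    intro a ha b hb c hc hbc h1 h2 hin
    rw [Finset.mem_sdiff] at ha
    have hb' := (hBU b hb).2.2.1
    have hc' := (hBU c hc).2.2.1
    refine h.not_canSwap j a b c ⟨ha.1, ha.2, hb', hc', hbc, (hrep.feas_iff _).2 hin, ?_, ?_⟩
    · exact hf.le_insert_of_subset (Finset.erase_subset _ _) (hb' j) h1
    · refine hf.le_insert_of_subset (Finset.insert_subset_insert _ (Finset.erase_subset _ _)) ?_ h2
      rw [Finset.mem_insert, not_or]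
      exact ⟨hbc.symm, hc' j⟩
  refine ⟨I', hI', B, fun b hb => (hBU b hb).1, hdisj', hind,
    hcard.trans (hrep.card_biUnion_le _), ?_, fun b hb => ⟨(hBU b hb).2.1, (hBU b hb).2.2.1⟩, ?_⟩
  · refine M.card_le_of_no_exchange hrep.disjoint hPσ hdisj hI hI' hdisj' hind hspan
      (fun u hu => (hBU u hu).2.1) (fun u hu => (hBU u hu).2.2.2) ?_
    intro a ha b hb c hc hbc
    rcases hB.2.marginal_pair hf (Finset.mem_union_right _ hb) ((hBU b hb).2.2.1 j)
      (Finset.mem_union_right _ hc) ((hBU c hc).2.2.1 j) hbc with h1 | h1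
    · exact hswap a ha b hb c hc hbc h1.1 h1.2
    · rw [Finset.insert_comm]
      exact hswap a ha c hc b hb hbc.symm h1.1 h1.2
  · intro o ho hoI hfree
    rcases Nat.lt_or_ge (v o ∩ (I \ I')).card 1 with h0 | h1
    · left
      have hsub : v o ⊆ I' := by
        have h0' : v o ∩ (I \ I') = ∅ := Finset.card_eq_zero.1 (by omega)
        intro x hx
        by_contra hxI
        have : x ∈ v o ∩ (I \ I') := by simp [hx, hoI hx, hxI]
        rw [h0'] at this
        simp at this
      refine ⟨hsub, ?_⟩
      by_contra! hlt
      refine h.not_canAdd j o ⟨hfree, (hrep.feas_iff _).2 (hind.subset ?_), hlt.le⟩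
      rw [Finset.coe_subset, Finset.biUnion_insert, Finset.union_comm]
      exact Finset.union_subset_union_right hsub
    · right
      by_cases hoB : o ∈ B
      · exact .inl hoB
      right
      rcases Nat.lt_or_ge 1 (v o ∩ (I \ I')).card with h2 | h2
      · exact .inl h2
      refine .inr ⟨h1, ?_⟩
      by_contra! hlt
      have hoU : o ∈ U := Finset.mem_filter.2 ⟨ho, hoI, hfree, le_antisymm h2 h1⟩
      have := hBmax (insert o B) (by
        rw [Finset.mem_filter, Finset.mem_powerset, Finset.union_insert]
        exact ⟨Finset.insert_subset hoU hB.1, hB.2.step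
          (by rw [Finset.mem_union, not_or]; exact ⟨hfree j, hoB⟩) hlt.le⟩)
      rw [Finset.card_insert_of_notMem hoB] at this
      omega

end Phase

/-! ### Runs of the local search with geometrically decreasing thresholds -/

section Run

variable {n l k : ℕ} {feas : Finset (Fin n) → Prop} {f : Finset (Fin n) → ℝ} {c : ℝ}
  {σ : ℕ → Fin l → Finset (Fin n)} {V : Type} [DecidableEq V] {M : Matroid V}
  {v : Fin n → Finset V}

/-- The guaranteed gain of the `j`-th solution in the first `T` phases. -/
noncomputable def gain (c : ℝ) (σ : ℕ → Fin l → Finset (Fin n)) (j : Fin l) (T : ℕ) : ℝ :=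
  ∑ t ∈ Finset.range T, c / 2 ^ t * (σ (t + 1) j \ σ t j).card

theorem gain_le {T : ℕ} (h0 : ∀ j, σ 0 j = ∅)
    (hσ : ∀ t < T, IsPhase feas f (c / 2 ^ t) (σ t) (σ (t + 1))) (j : Fin l) :
    f ∅ + gain c σ j T ≤ f (σ T j) := by
  induction T with
  | zero => simp [gain, h0]
  | succ T ih =>
    have h1 := ih fun t ht => hσ t (by omega)
    have h2 := ((hσ T (by omega)).dense j).add_card_le
    rw [gain, Finset.sum_range_succ]
    rw [gain] at h1
    linarith

theorem disjoint_and_feasible {T : ℕ} (hempty : feas ∅) (h0 : ∀ j, σ 0 j = ∅)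
    (hσ : ∀ t < T, IsPhase feas f (c / 2 ^ t) (σ t) (σ (t + 1))) :
    (Pairwise fun i j => Disjoint (σ T i) (σ T j)) ∧ ∀ j, feas (σ T j) := by
  rcases T with _ | T
  · simp only [h0]
    exact ⟨fun i j _ => by simp, fun _ => hempty⟩
  · exact ⟨(hσ T (by omega)).disjoint, (hσ T (by omega)).feasible⟩

/-- Charging scheme: up to a set `B` of negligible value, every element `o` of the independent set
`O` is in the `j`-th solution, or still available, or has received a payment `p o` that is at least
a (scaled) power of two that bounds its marginal values from now on. -/
theorem exists_payment_aux (hrep : ParityRep k feas M v) (hf : IsSubmodular f) (hc : 0 ≤ c)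
    (h0 : ∀ j, σ 0 j = ∅) (j : Fin l) {O : Finset (Fin n)} (hO : feas O)
    (hOc : ∀ o ∈ O, f {o} ≤ f ∅ + 2 * c) (T : ℕ)
    (hσ : ∀ t < T, IsPhase feas f (c / 2 ^ t) (σ t) (σ (t + 1))) :
    ∃ (I : Finset V) (B : Finset (Fin n)) (p : Fin n → ℝ),
      Disjoint ((σ T j).biUnion v) I ∧ M.Indep (↑((σ T j).biUnion v ∪ I) : Set V) ∧
      (∀ o, 0 ≤ p o) ∧ B ⊆ O ∧
      (∑ o ∈ O, p o ≤ k * gain c σ j T + 2 * ∑ i, gain c σ i T) ∧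
      (∀ X, σ T j ⊆ X → f (X ∪ B) ≤ f X + 2 * gain c σ j T) ∧
      ∀ o ∈ O, o ∈ σ T j ∨ o ∈ B ∨
        (IsFree (σ T) o ∧ v o ⊆ I ∧ f (insert o (σ T j)) ≤ f (σ T j) + 2 * (c / 2 ^ T)) ∨
        ∃ z : ℤ, c * 2 ^ z ≤ p o ∧
          ∀ X, σ T j ⊆ X → B ⊆ X → f (insert o X) ≤ f X + c * 2 ^ z := by
  classical
  induction T with
  | zero =>
    -- At the start every edge of `O` is available and nothing has been paid.
    refine ⟨O.biUnion v, ∅, 0, by simp [h0], by simpa [h0] using (hrep.feas_iff O).1 hO,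
      by simp, by simp, by simp [gain], by simp [gain], ?_⟩
    intro o ho
    refine .inr (.inr (.inl ⟨fun i => by simp [h0], Finset.subset_biUnion_of_mem v ho, ?_⟩))
    simpa [h0] using hOc o ho
  | succ T ih =>
    obtain ⟨I, B, p, hdisj, hI, hp, hBO, hsum, hB, hcase⟩ := ih fun t ht => hσ t (by omega)
    have hphase := hσ T (by omega)
    set τ := c / 2 ^ T with hτ
    have hτ0 : 0 ≤ τ := by positivity
    set O' := O.filter fun o => IsFree (σ T) o ∧ v o ⊆ I ∧
      f (insert o (σ T j)) ≤ f (σ T j) + 2 * τ with hO'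
    obtain ⟨I', hI', B', hB'O, hdisj', hind', hcardI, hcardB, hB'f, hcase'⟩ :=
      hphase.exists_extension hrep hf j O' hdisj hI
    have hmono := (hphase.dense j).subset
    have hg : ∀ i, gain c σ i (T + 1) = gain c σ i T + τ * (σ (T + 1) i \ σ T i).card := by
      intro i
      rw [gain, Finset.sum_range_succ, ← gain]
    have hτz : τ = c * 2 ^ (-(T : ℤ)) := by
      rw [zpow_neg, zpow_natCast, hτ, div_eq_mul_inv]
    have hτz2 : 2 * τ = c * 2 ^ (1 - (T : ℤ)) := by
      rw [sub_eq_add_neg, zpow_add₀ (by norm_num), hτz, zpow_one]; ring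
    -- In this phase an edge receives τ for each vertex that it loses, and 2τ for each solution that
    -- newly contains it.
    refine ⟨I', B ∪ B', fun o => p o + τ * (v o ∩ (I \ I')).card +
      2 * τ * (∑ i, if o ∈ σ (T + 1) i \ σ T i then 1 else 0), hdisj', hind', ?_, ?_, ?_, ?_, ?_⟩
    · intro o
      have : 0 ≤ (∑ i, if o ∈ σ (T + 1) i \ σ T i then (1 : ℝ) else 0) :=
        Finset.sum_nonneg fun i _ => by split_ifs <;> norm_num
      have := hp o
      positivity
    · exact Finset.union_subset hBO (hB'O.trans (Finset.filter_subset _ _))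
    · rw [Finset.sum_add_distrib, Finset.sum_add_distrib, ← Finset.mul_sum, ← Finset.mul_sum,
        Finset.sum_comm, hg j]
      have h1 : ∑ o ∈ O, ((v o ∩ (I \ I')).card : ℝ) ≤ k * (σ (T + 1) j \ σ T j).card := by
        have : ∑ o ∈ O, (v o ∩ (I \ I')).card ≤ (I \ I').card := by
          rw [← Finset.card_biUnion]
          · exact Finset.card_le_card (Finset.biUnion_subset.2 fun o _ => Finset.inter_subset_right)
          · intro a _ b _ hab
            exact (hrep.disjoint hab).mono Finset.inter_subset_left Finset.inter_subset_left
        exact_mod_cast this.trans hcardI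
      have h2 : ∑ i, ∑ o ∈ O, (if o ∈ σ (T + 1) i \ σ T i then (1 : ℝ) else 0) ≤
          ∑ i, ((σ (T + 1) i \ σ T i).card : ℝ) := by
        refine Finset.sum_le_sum fun i _ => ?_
        rw [Finset.sum_boole]
        exact_mod_cast Finset.card_le_card fun o ho => (Finset.mem_filter.1 ho).2
      have h3 : ∑ i, gain c σ i (T + 1) =
          ∑ i, gain c σ i T + τ * ∑ i, ((σ (T + 1) i \ σ T i).card : ℝ) := by
        rw [Finset.mul_sum, ← Finset.sum_add_distrib]
        exact Finset.sum_congr rfl fun i _ => hg i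
      rw [h3]
      have h4 := mul_le_mul_of_nonneg_left h1 hτ0
      have h5 := mul_le_mul_of_nonneg_left h2 hτ0
      linarith
    · intro X hX
      -- Edges set aside in this phase were still available, so each is worth at most 2τ and there
      -- are at most as many of them as new edges in the `j`-th solution.
      have h1 := hB X (hmono.trans hX)
      have h2 := hf.union_le_add_card (A := σ T j) (X := X ∪ B) (B := B') (c := 2 * τ)
        ((hmono.trans hX).trans Finset.subset_union_left) (by positivity)
        fun b hb => (Finset.mem_filter.1 (hB'O hb)).2.2.2
      have h3 : (B'.card : ℝ) ≤ (σ (T + 1) j \ σ T j).card := by exact_mod_cast hcardB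
      have h4 := mul_le_mul_of_nonneg_left h3 hτ0
      rw [hg, ← Finset.union_assoc]
      linarith
    · intro o ho
      have hind0 : ∀ i, (0 : ℝ) ≤ if o ∈ σ (T + 1) i \ σ T i then 1 else 0 :=
        fun i => by split_ifs <;> norm_num
      have hsum0 : 0 ≤ (∑ i, if o ∈ σ (T + 1) i \ σ T i then (1 : ℝ) else 0) :=
        Finset.sum_nonneg fun i _ => hind0 i
      have hpo := hp o
      rcases hcase o ho with h | h | h | ⟨z, hz, hzX⟩
      · exact .inl (hmono h)
      · exact .inr (.inl (Finset.mem_union_left _ h))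
      · by_cases hfree : IsFree (σ (T + 1)) o
        · rcases hcase' o (Finset.mem_filter.2 ⟨ho, h⟩) h.2.1 hfree with h' | h' | h' | h'
          · refine .inr (.inr (.inl ⟨hfree, h'.1, ?_⟩))
            have : 2 * (c / 2 ^ (T + 1)) = τ := by rw [hτ, pow_succ]; field_simp
            rw [this]
            exact h'.2
          · exact .inr (.inl (Finset.mem_union_right _ h'))
          -- Two lost vertices pay 2τ, which is the bound on the marginal before the phase.
          · refine .inr (.inr (.inr ⟨1 - T, ?_, fun X hX _ => ?_⟩))
            · rw [← hτz2]
              have h2 : (2 : ℝ) ≤ (v o ∩ (I \ I')).card := by exact_mod_cast h'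
              have := mul_le_mul_of_nonneg_left h2 hτ0
              have : 0 ≤ 2 * τ * (∑ i, if o ∈ σ (T + 1) i \ σ T i then (1 : ℝ) else 0) := by
                positivity
              linarith
            · rw [← hτz2]
              exact hf.insert_le_of_subset (hmono.trans hX) (by positivity) h.2.2
          -- One lost vertex pays τ, which suffices once `B'` is included in `X`.
          · refine .inr (.inr (.inr ⟨-T, ?_, fun X hX hBX => ?_⟩))
            · rw [← hτz]
              have h2 : (1 : ℝ) ≤ (v o ∩ (I \ I')).card := by exact_mod_cast h'.1
              have := mul_le_mul_of_nonneg_left h2 hτ0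
              have : 0 ≤ 2 * τ * (∑ i, if o ∈ σ (T + 1) i \ σ T i then (1 : ℝ) else 0) := by
                positivity
              linarith
            · rw [← hτz]
              exact hf.insert_le_of_subset (Finset.union_subset hX
                (Finset.subset_union_right.trans hBX)) hτ0 h'.2
        -- Some solution took the edge in this phase, since the edge was free before; this pays 2τ.
        · refine .inr (.inr (.inr ⟨1 - T, ?_, fun X hX _ => ?_⟩))
          · rw [← hτz2]
            unfold IsFree at hfree
            push Not at hfree
            obtain ⟨i, hi⟩ := hfree
            have h1 := Finset.single_le_sum (fun i _ => hind0 i) (Finset.mem_univ i)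
            rw [if_pos (Finset.mem_sdiff.2 ⟨hi, h.1 i⟩)] at h1
            have := mul_le_mul_of_nonneg_left h1 hτ0
            have : 0 ≤ τ * ((v o ∩ (I \ I')).card : ℝ) := by positivity
            linarith
          · rw [← hτz2]
            exact hf.insert_le_of_subset (hmono.trans hX) (by positivity) h.2.2
      · refine .inr (.inr (.inr ⟨z, ?_, fun X hX hBX => hzX X (hmono.trans hX)
          (Finset.subset_union_left.trans hBX)⟩))
        have : 0 ≤ τ * ((v o ∩ (I \ I')).card : ℝ) := by positivity
        have : 0 ≤ 2 * τ * (∑ i, if o ∈ σ (T + 1) i \ σ T i then (1 : ℝ) else 0) := by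
          positivity
        linarith

/-- A complete run of the local search with initial threshold `c`. -/
structure IsRun (feas : Finset (Fin n) → Prop) (f : Finset (Fin n) → ℝ) (c : ℝ)
    (σ : ℕ → Fin l → Finset (Fin n)) : Prop where
  init : ∀ j, σ 0 j = ∅
  phase : ∀ t < n, IsPhase feas f (c / 2 ^ t) (σ t) (σ (t + 1))

/-- The marginal value of `o` over the smaller elements of `O`. -/
noncomputable def orderedMarginal (f : Finset (Fin n) → ℝ) (O : Finset (Fin n)) (o : Fin n) : ℝ :=
  f (insert o (O.filter (· < o))) - f (O.filter (· < o))

theorem sum_orderedMarginal (f : Finset (Fin n) → ℝ) (O : Finset (Fin n)) :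
    ∑ o ∈ O, orderedMarginal f O o = f O - f ∅ := by
  simpa only [orderedMarginal, Finset.empty_union] using sum_marginals_eq f ∅ O

/-- The marginal over the smaller elements is at least the marginal over all of `O.erase o`, which
is non-negative by `hmax`. -/
theorem orderedMarginal_nonneg (hf : IsSubmodular f) {O : Finset (Fin n)}
    (hmax : ∀ o ∈ O, f (O.erase o) ≤ f O) {o : Fin n} (ho : o ∈ O) :
    0 ≤ orderedMarginal f O o := by
  have := hf.le_insert_of_subset (S := O.filter (· < o)) (T := O.erase o) (e := o) (c := 0)
    (fun x hx => Finset.mem_erase.2 ⟨(Finset.mem_filter.1 hx).2.ne, (Finset.mem_filter.1 hx).1⟩)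
    (by simp) (by rw [Finset.insert_erase ho]; linarith [hmax o ho])
  rw [orderedMarginal]
  linarith

/-- The charging scheme is applied to a solution that costs `O` little. Here `y o` is the marginal
of `o` over that solution, the set-aside edges and the smaller edges of `O`. These marginals
telescope to almost `f O`, and positive ones are covered by rounded payments. -/
theorem IsRun.exists_payment (h : IsRun feas f c σ) (hrep : ParityRep k feas M v)
    (hf : IsSubmodular f) (hf0 : ∀ S, 0 ≤ f S) (hl : 0 < l) (hc : 0 ≤ c) {O : Finset (Fin n)}
    (hO : feas O) (hmax : ∀ o ∈ O, f (O.erase o) ≤ f O) (hOc : ∀ o ∈ O, f {o} ≤ f ∅ + 2 * c)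
    {F : ℝ} (hF : ∀ j, f (σ n j) ≤ F) (hcF : c ≤ 2 * F) :
    ∃ p y : Fin n → ℝ, (∀ o, 0 ≤ p o) ∧ (∀ o ∈ O, y o ≤ orderedMarginal f O o) ∧
      ∑ o ∈ O, p o ≤ (k + 2 * l + 4) * F ∧
      (1 - 1 / (l : ℝ)) * f O - 3 * F ≤ ∑ o ∈ O, y o ∧
      ∀ o ∈ O, y o ≤ 0 ∨ ∃ z : ℤ, y o ≤ c * 2 ^ z ∧ c * 2 ^ z ≤ p o := by
  have hg : ∀ j, gain c σ j n ≤ F := fun j => by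
    have := gain_le h.init h.phase j
    linarith [hf0 ∅, hF j]
  have hempty : feas ∅ := (hrep.feas_iff ∅).2 (by simp)
  obtain ⟨j, hj⟩ := hf.exists_union_ge hf0 hl (disjoint_and_feasible hempty h.init h.phase).1 O
  obtain ⟨I, B, p, -, -, hp, hBO, hsum, hB, hcase⟩ :=
    exists_payment_aux hrep hf hc h.init j hO hOc n h.phase
  set Z := σ n j ∪ B with hZ
  have hsumy := sum_marginals_eq f Z O
  have hZO : Z ∪ O = O ∪ σ n j := by
    rw [hZ, Finset.union_assoc, Finset.union_eq_right.2 hBO, Finset.union_comm]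
  rw [hZO] at hsumy
  have hfZ := hB (σ n j) subset_rfl
  have hu : 0 ≤ 2 * (c / 2 ^ n) := by positivity
  have hzero : ∀ o, o ∈ Z → f (insert o (Z ∪ O.filter (· < o))) - f (Z ∪ O.filter (· < o)) = 0 := by
    intro o ho
    rw [Finset.insert_eq_of_mem (Finset.mem_union_left _ ho), sub_self]
  -- The extra payment serves the edges that are still available after the last phase. As `O.card ≤
  -- 2 ^ n`, it costs at most `2 * c ≤ 4 * F` in all; this is why `n` phases suffice.
  refine ⟨fun o => p o + 2 * (c / 2 ^ n),
    fun o => f (insert o (Z ∪ O.filter (· < o))) - f (Z ∪ O.filter (· < o)),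
    fun o => add_nonneg (hp o) hu, ?_, ?_, ?_, ?_⟩
  · intro o ho
    by_cases hoZ : o ∈ Z
    · simp only [hzero o hoZ]
      exact orderedMarginal_nonneg hf hmax ho
    · exact hf _ _ Finset.subset_union_right o (by simp [hoZ])
  · rw [Finset.sum_add_distrib, Finset.sum_const, nsmul_eq_mul]
    have h1 : (O.card : ℝ) ≤ 2 ^ n := by
      have : O.card ≤ n := by simpa using Finset.card_le_univ O
      exact_mod_cast this.trans Nat.lt_two_pow_self.le
    have h2 : (O.card : ℝ) * (2 * (c / 2 ^ n)) ≤ 4 * F := by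
      have : (2 : ℝ) ^ n * (2 * (c / 2 ^ n)) = 2 * c := by field_simp
      have := mul_le_mul_of_nonneg_right h1 hu
      linarith
    have h3 : ∑ i, gain c σ i n ≤ l * F := by
      have := Finset.sum_le_sum fun (i : Fin l) (_ : i ∈ Finset.univ) => hg i
      simpa using this
    have h4 := mul_le_mul_of_nonneg_left (hg j) (Nat.cast_nonneg (α := ℝ) k)
    linarith
  · simp only
    rw [hsumy]
    linarith [hg j, hF j]
  · intro o ho
    have hsub : σ n j ⊆ Z ∪ O.filter (· < o) :=
      Finset.subset_union_left.trans Finset.subset_union_left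
    rcases hcase o ho with h | h | h | ⟨z, hz, hzX⟩
    · exact .inl (hzero o (Finset.mem_union_left _ h)).le
    · exact .inl (hzero o (Finset.mem_union_right _ h)).le
    · refine .inr ⟨1 - n, ?_, ?_⟩ <;>
      rw [sub_eq_add_neg, zpow_add₀ (by norm_num), zpow_neg, zpow_natCast, zpow_one]
      · have := hf.insert_le_of_subset hsub hu h.2.2
        calc _ ≤ 2 * (c / 2 ^ n) := by linarith
          _ = _ := by ring
      · calc c * (2 * (2 ^ n)⁻¹) = 2 * (c / 2 ^ n) := by ring
          _ ≤ _ := by linarith [hp o]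
    · refine .inr ⟨z, ?_, by linarith⟩
      have := hzX _ hsub (Finset.subset_union_right.trans Finset.subset_union_left)
      linarith

end Run

/-! ### Combination of three shifted runs -/

/-- Let `x < y ≤ 2 * x` with `x` on the first grid. According to whether `y` is at most `5 / 4 * x`,
at most `8 / 5 * x`, or larger, the roundings sum to at least `4.85 * x`, `6.1 * x` or `7.7 * x`.
The middle case is the worst and gives `6.1 / 1.6 = 61 / 16`. -/
theorem shifted_powers_sum {W y : ℝ} {a b c : ℤ} (hy : 0 < y) (ha : y ≤ W * 2 ^ a)
    (hb : y ≤ 5 / 4 * W * 2 ^ b) (hc : y ≤ 8 / 5 * W * 2 ^ c) :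
    61 / 16 * y ≤ W * 2 ^ a + 5 / 4 * W * 2 ^ b + 8 / 5 * W * 2 ^ c := by
  have hpow : ∀ z : ℤ, (0 : ℝ) < 2 ^ z := fun z => by positivity
  have hW : 0 < W := by
    by_contra! h
    have := mul_nonpos_of_nonpos_of_nonneg h (hpow a).le
    linarith
  obtain ⟨t, ht1, ht2⟩ := exists_mem_Ioc_zpow (div_pos hy hW) (one_lt_two (α := ℝ))
  rw [lt_div_iff₀ hW] at ht1
  rw [div_le_iff₀ hW, zpow_add_one₀ two_ne_zero] at ht2
  have hstep : ∀ {s z : ℤ}, (2 : ℝ) ^ s < 2 ^ z → 2 * (2 : ℝ) ^ s ≤ 2 ^ z := by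
    intro s z h
    have h1 : s + 1 ≤ z := (zpow_lt_zpow_iff_right₀ one_lt_two).1 h
    have h2 : (2 : ℝ) ^ (s + 1) ≤ 2 ^ z := zpow_le_zpow_right₀ one_le_two h1
    rw [zpow_add_one₀ two_ne_zero] at h2
    linarith
  have hstep' : ∀ {s z : ℤ}, (2 : ℝ) ^ s < 2 * 2 ^ z → (2 : ℝ) ^ s ≤ 2 ^ z := by
    intro s z h
    by_contra! h'
    have := hstep h'
    linarith
  set x := (2 : ℝ) ^ t * W with hx
  have hxa : 2 * x ≤ W * 2 ^ a := by
    have h1 : (2 : ℝ) ^ t < 2 ^ a := lt_of_mul_lt_mul_right (a := W) (by linarith) hW.le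
    have := mul_le_mul_of_nonneg_left (hstep h1) hW.le
    linarith
  -- A grid point above `y` on the grid with shift `s` is at least `s * x`, and at least twice that
  -- if `y` exceeds `s * x`.
  have lower : ∀ {s : ℝ} {z : ℤ}, 1 ≤ s → s < 2 → y ≤ s * W * 2 ^ z →
      s * x ≤ s * W * 2 ^ z ∧ (s * x < y → 2 * s * x ≤ s * W * 2 ^ z) := by
    intro s z hs1 hs2 hs
    have hsW : 0 < s * W := by positivity
    constructor
    · have h1 : (2 : ℝ) ^ t < 2 * 2 ^ z := by
        refine lt_of_mul_lt_mul_right (a := W) ?_ hW.le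
        have := mul_lt_mul_of_pos_right hs2 (mul_pos hW (hpow z))
        linarith
      have := mul_le_mul_of_nonneg_left (hstep' h1) hsW.le
      linarith
    · intro hlt
      have h1 : (2 : ℝ) ^ t < 2 ^ z := lt_of_mul_lt_mul_left (a := s * W) (by linarith) hsW.le
      have := mul_le_mul_of_nonneg_left (hstep h1) hsW.le
      linarith
  obtain ⟨hb1, hb2⟩ := lower (by norm_num) (by norm_num) hb
  obtain ⟨hc1, hc2⟩ := lower (by norm_num) (by norm_num) hc
  rcases le_or_gt y (5 / 4 * x) with h | h
  · linarith
  · have hb3 := hb2 h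
    rcases le_or_gt y (8 / 5 * x) with h' | h'
    · linarith
    · have hc3 := hc2 h'
      linarith

/-- If some `yᵢ` falls short of `w` by at least `w / 50`, the penalty with factor 50 makes the left
side non-positive. Otherwise all three payments are grid points above `49 / 50 * w`, and the bound
for shifted grids applies. -/
theorem payment_sum {W w y₁ y₂ y₃ p₁ p₂ p₃ : ℝ} (hw : 0 ≤ w) (hp₁ : 0 ≤ p₁) (hp₂ : 0 ≤ p₂)
    (hp₃ : 0 ≤ p₃) (hy₁ : y₁ ≤ w) (hy₂ : y₂ ≤ w) (hy₃ : y₃ ≤ w)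
    (h₁ : y₁ ≤ 0 ∨ ∃ z : ℤ, y₁ ≤ W * 2 ^ z ∧ W * 2 ^ z ≤ p₁)
    (h₂ : y₂ ≤ 0 ∨ ∃ z : ℤ, y₂ ≤ 5 / 4 * W * 2 ^ z ∧ 5 / 4 * W * 2 ^ z ≤ p₂)
    (h₃ : y₃ ≤ 0 ∨ ∃ z : ℤ, y₃ ≤ 8 / 5 * W * 2 ^ z ∧ 8 / 5 * W * 2 ^ z ≤ p₃) :
    61 / 16 * (49 / 50 * w - 50 * ((w - y₁) + (w - y₂) + (w - y₃))) ≤ p₁ + p₂ + p₃ := by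
  rcases le_or_gt y₁ (49 / 50 * w) with hs | hs₁
  · linarith
  rcases le_or_gt y₂ (49 / 50 * w) with hs | hs₂
  · linarith
  rcases le_or_gt y₃ (49 / 50 * w) with hs | hs₃
  · linarith
  rcases hw.eq_or_lt with rfl | hw
  · linarith
  obtain ⟨z₁, hz₁, hz₁'⟩ := h₁.resolve_left (by linarith)
  obtain ⟨z₂, hz₂, hz₂'⟩ := h₂.resolve_left (by linarith)
  obtain ⟨z₃, hz₃, hz₃'⟩ := h₃.resolve_left (by linarith)
  have := shifted_powers_sum (W := W) (y := 49 / 50 * w) (by linarith) (hs₁.le.trans hz₁)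
    (hs₂.le.trans hz₂) (hs₃.le.trans hz₃)
  linarith

/-- The value of every feasible set in terms of the best of the solutions of three runs. -/
theorem approximation_ratio {n k : ℕ} {feas : Finset (Fin n) → Prop} {f : Finset (Fin n) → ℝ}
    (hM : IsMatroidParity k feas) (hf : IsSubmodular f) (hf0 : ∀ S, 0 ≤ f S) {W F : ℝ} (hW : 0 ≤ W)
    (hWF : W ≤ F) (hsingle : ∀ o, feas {o} → f {o} ≤ W)
    {σ₁ σ₂ σ₃ : ℕ → Fin 10000 → Finset (Fin n)} (h₁ : IsRun feas f W σ₁)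
    (h₂ : IsRun feas f (5 / 4 * W) σ₂) (h₃ : IsRun feas f (8 / 5 * W) σ₃)
    (hF₁ : ∀ j, f (σ₁ n j) ≤ F) (hF₂ : ∀ j, f (σ₂ n j) ≤ F) (hF₃ : ∀ j, f (σ₃ n j) ≤ F)
    {S : Finset (Fin n)} (hS : feas S) : f S ≤ (0.818 * k + 20000) * F := by
  classical
  obtain ⟨V, M, v, hrep⟩ := hM.exists_rep
  have hdown : ∀ {X Y : Finset (Fin n)}, X ⊆ Y → feas Y → feas X := fun hXY hY =>
    (hrep.feas_iff _).2 (((hrep.feas_iff _).1 hY).subset (Finset.coe_subset.2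
      (Finset.biUnion_subset_biUnion_of_subset_left _ hXY)))
  -- Passing to the best subset of `S` makes all ordered marginals non-negative.
  obtain ⟨O, hOS, hOmax⟩ := Finset.exists_max_image S.powerset f ⟨S, by simp⟩
  rw [Finset.mem_powerset] at hOS
  have hO := hdown hOS hS
  have hmax : ∀ o ∈ O, f (O.erase o) ≤ f O := fun o _ =>
    hOmax _ (Finset.mem_powerset.2 ((Finset.erase_subset _ _).trans hOS))
  have hfS : f S ≤ f O := hOmax S (by simp)
  have hOW : ∀ o ∈ O, f {o} ≤ W := fun o ho =>
    hsingle o (hdown (Finset.singleton_subset_iff.2 ho) hO)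
  have hempty := hf0 ∅
  have hF0 : 0 ≤ F := hW.trans hWF
  obtain ⟨p₁, y₁, hp₁, hy₁, hs₁, ht₁, hc₁⟩ := h₁.exists_payment hrep hf hf0 (by norm_num) hW hO hmax
    (fun o ho => by linarith [hOW o ho]) hF₁ (by linarith)
  obtain ⟨p₂, y₂, hp₂, hy₂, hs₂, ht₂, hc₂⟩ := h₂.exists_payment hrep hf hf0 (by norm_num)
    (by linarith) hO hmax (fun o ho => by linarith [hOW o ho]) hF₂ (by linarith)
  obtain ⟨p₃, y₃, hp₃, hy₃, hs₃, ht₃, hc₃⟩ := h₃.exists_payment hrep hf hf0 (by norm_num)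
    (by linarith) hO hmax (fun o ho => by linarith [hOW o ho]) hF₃ (by linarith)
  have hw := sum_orderedMarginal f O
  have key : ∑ o ∈ O, (61 / 16 * (49 / 50 * orderedMarginal f O o -
      50 * ((orderedMarginal f O o - y₁ o) + (orderedMarginal f O o - y₂ o) +
        (orderedMarginal f O o - y₃ o)))) ≤ ∑ o ∈ O, (p₁ o + p₂ o + p₃ o) :=
    Finset.sum_le_sum fun o ho => payment_sum (orderedMarginal_nonneg hf hmax ho) (hp₁ o) (hp₂ o)
      (hp₃ o) (hy₁ o ho) (hy₂ o ho) (hy₃ o ho) (hc₁ o ho) (hc₂ o ho) (hc₃ o ho)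
  simp only [← Finset.mul_sum, Finset.sum_add_distrib, Finset.sum_sub_distrib, hw] at key
  push_cast at hs₁ hs₂ hs₃ ht₁ ht₂ ht₃
  have hfO := hf0 O
  -- The coefficient of `f O` is `61 / 16 * (49 / 50 - 150 / 10000)`, about 3.679, against `3 * k *
  -- F` plus about `61728 * F`. The quotients are below 0.8155 and 16800, and the terms with `f ∅`
  -- have the favourable sign.
  linarith

/-! ### Sequences of moves -/

section MoveSequences

variable {n l : ℕ} (feas : Finset (Fin n) → Prop) (f : Finset (Fin n) → ℝ) (τ : ℝ)
  (P : Fin l → Finset (Fin n))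

/-- A local improvement of one of the solutions. -/
inductive Move : (Fin l → Finset (Fin n)) → (Fin l → Finset (Fin n)) → Prop
  | add {σ : Fin l → Finset (Fin n)} {j : Fin l} {b : Fin n} (h : CanAdd feas f τ σ j b) :
      Move σ (Function.update σ j (insert b (σ j)))
  | swap {σ : Fin l → Finset (Fin n)} {j : Fin l} {a b c : Fin n}
      (h : CanSwap feas f τ P σ j a b c) :
      Move σ (Function.update σ j (insert c (insert b ((σ j).erase a))))

/-- The properties of a family of solutions that moves preserve. -/
structure IsGood (σ : Fin l → Finset (Fin n)) : Prop where
  disjoint : Pairwise fun i j => Disjoint (σ i) (σ j)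
  feasible : ∀ j, feas (σ j)
  steep : ∀ j, SteepExtension f τ (P j) (σ j)

variable {feas f τ P} {σ σ' : Fin l → Finset (Fin n)}

theorem IsGood.update (h : IsGood feas f τ P σ) {j : Fin l} {X : Finset (Fin n)}
    (hX : ∀ x ∈ X, x ∈ σ j ∨ IsFree σ x) (hfeas : feas X) (hsteep : SteepExtension f τ (P j) X) :
    IsGood feas f τ P (Function.update σ j X) := by
  have hd : ∀ i, i ≠ j → Disjoint X (σ i) := by
    intro i hi
    rw [Finset.disjoint_left]
    intro x hx hxi
    rcases hX x hx with h' | h'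
    · exact Finset.disjoint_left.1 (h.disjoint hi) hxi h'
    · exact h' i hxi
  refine ⟨fun i i' hii => ?_, fun i => ?_, fun i => ?_⟩
  · by_cases hi : i = j
    · subst hi
      simpa [Function.update_of_ne hii.symm] using hd i' hii.symm
    · by_cases hi' : i' = j
      · subst hi'
        simpa [Function.update_of_ne hi] using (hd i hi).symm
      · simpa [Function.update_of_ne hi, Function.update_of_ne hi'] using h.disjoint hii
  · by_cases hi : i = j
    · subst hi; simpa using hfeas
    · simpa [Function.update_of_ne hi] using h.feasible i
  · by_cases hi : i = j
    · subst hi; simpa using hsteep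
    · simpa [Function.update_of_ne hi] using h.steep i

/-- New edges are free, so disjointness persists. A swap only removes an edge outside `P j`, so the
solution stays a steep extension. -/
theorem Move.isGood (hf : IsSubmodular f) (h : Move feas f τ P σ σ') (hσ : IsGood feas f τ P σ) :
    IsGood feas f τ P σ' := by
  cases h with
  | @add j b h =>
    refine hσ.update (fun x hx => ?_) h.2.1 ((hσ.steep j).step (h.1 j) h.2.2)
    rcases Finset.mem_insert.1 hx with rfl | hx
    · exact .inr h.1
    · exact .inl hx
  | @swap j a b c h =>
    obtain ⟨-, haP, hb, hc, hbc, hfeas, h1, h2⟩ := h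
    refine hσ.update (fun x hx => ?_) hfeas
      ((((hσ.steep j).erase hf haP).step (fun h => hb j (Finset.mem_of_mem_erase h)) h1).step ?_ h2)
    · rcases Finset.mem_insert.1 hx with rfl | hx
      · exact .inr hc
      rcases Finset.mem_insert.1 hx with rfl | hx
      · exact .inr hb
      · exact .inl (Finset.mem_of_mem_erase hx)
    · rw [Finset.mem_insert, not_or]
      exact ⟨hbc.symm, fun h => hc j (Finset.mem_of_mem_erase h)⟩

theorem sum_card_lt_update {j : Fin l} {X : Finset (Fin n)} (h : (σ j).card < X.card) :
    ∑ i, (σ i).card < ∑ i, (Function.update σ j X i).card := by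
  refine Finset.sum_lt_sum (fun i _ => ?_) ⟨j, Finset.mem_univ _, by simpa using h⟩
  by_cases hi : i = j
  · subst hi; simpa using h.le
  · rw [Function.update_of_ne hi]

theorem Move.sum_card_lt (h : Move feas f τ P σ σ') : ∑ i, (σ i).card < ∑ i, (σ' i).card := by
  cases h with
  | @add j b h =>
    refine sum_card_lt_update ?_
    rw [Finset.card_insert_of_notMem (h.1 j)]
    omega
  | @swap j a b c h =>
    obtain ⟨ha, -, hb, hc, hbc, -⟩ := h
    refine sum_card_lt_update ?_
    rw [Finset.card_insert_of_notMem, Finset.card_insert_of_notMem]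
    · have := Finset.card_erase_add_one ha
      omega
    · exact fun h => hb j (Finset.mem_of_mem_erase h)
    · rw [Finset.mem_insert, not_or]
      exact ⟨hbc.symm, fun h => hc j (Finset.mem_of_mem_erase h)⟩

open Relation

theorem isGood_of_transGen (hf : IsSubmodular f) (h : TransGen (Move feas f τ P) σ σ')
    (hσ : IsGood feas f τ P σ) : IsGood feas f τ P σ' := by
  induction h with
  | single h => exact h.isGood hf hσ
  | tail _ h ih => exact h.isGood hf ih

theorem sum_card_lt_of_transGen (h : TransGen (Move feas f τ P) σ σ') :
    ∑ i, (σ i).card < ∑ i, (σ' i).card := by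
  induction h with
  | single h => exact h.sum_card_lt
  | tail _ h ih => exact ih.trans h.sum_card_lt

theorem IsGood.sum_card_le (h : IsGood feas f τ P σ) : ∑ i, (σ i).card ≤ n := by
  rw [← Finset.card_biUnion fun i _ j _ hij => h.disjoint hij]
  simpa using Finset.card_le_univ (Finset.univ.biUnion σ)

variable (feas f τ P σ) in
/-- No move is possible. -/
def IsStuck : Prop :=
  (∀ j b, ¬ CanAdd feas f τ σ j b) ∧ ∀ j a b c, ¬ CanSwap feas f τ P σ j a b c

theorem IsStuck.not_transGen (h : IsStuck feas f τ P σ) : ¬ TransGen (Move feas f τ P) σ σ' := by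
  intro h'
  obtain ⟨_, h1, -⟩ := TransGen.head'_iff.1 h'
  cases h1 with
  | add h1 => exact h.1 _ _ h1
  | swap h1 => exact h.2 _ _ _ _ h1

/-- Either `y = x`, and `N` holds, or `y` is reached from `x` in at least one step. -/
def Progress {α : Type} (R : α → α → Prop) (N : Prop) (x y : α) : Prop :=
  (y = x ∧ N) ∨ TransGen R x y

theorem Progress.refl {α : Type} {R : α → α → Prop} {N : Prop} (h : N) (x : α) :
    Progress R N x x := .inl ⟨rfl, h⟩

/-- Composition of two steps; the second one need not be known if the first one made progress. -/
theorem Progress.trans {α : Type} {R : α → α → Prop} {N N' N'' : Prop} {x y z : α}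
    (h : Progress R N x y) (h' : Progress R N' y z) (hN : x = y → N → N' → N'') :
    Progress R N'' x z := by
  rcases h with ⟨rfl, hx⟩ | h
  · rcases h' with ⟨rfl, hy⟩ | h'
    · exact .inl ⟨rfl, hN rfl hx hy⟩
    · exact .inr h'
  · rcases h' with ⟨rfl, -⟩ | h'
    · exact .inr h
    · exact .inr (h.trans h')

end MoveSequences

/-! ### Deterministic executions -/

section Execution

variable {n : ℕ} {O : Oracles n}

/-- From the memory `s`, the program `c` terminates without random draws, within `T` steps, in a
memory that satisfies `Q`. -/
def Runs (O : Oracles n) (c : Prog) (s : Memory n) (T : ℕ) (Q : Memory n → Prop) : Prop :=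
  ∃ t ≤ T, ∃ s', Q s' ∧ ∀ K t', run O (t + t') (c :: K) s = run O t' K s'

namespace Runs

variable {c c' : Prog} {s : Memory n} {T T' : ℕ} {Q Q' : Memory n → Prop} {b : Test}

theorem mono (h : Runs O c s T Q) (hT : T ≤ T') (hQ : ∀ s, Q s → Q' s) : Runs O c s T' Q' := by
  obtain ⟨t, ht, s', hs, h⟩ := h
  exact ⟨t, ht.trans hT, s', hQ _ hs, h⟩

theorem post (h : Runs O c s T Q) (hQ : ∀ s, Q s → Q' s) : Runs O c s T Q' := h.mono le_rfl hQ

theorem of_le (h : Runs O c s T Q) (hT : T ≤ T') : Runs O c s T' Q := h.mono hT fun _ => id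

theorem instr {o : Instr} (h : Q (o.exec O s)) : Runs O (.instr o) s 1 Q :=
  ⟨1, le_rfl, _, h, fun K t' => by rw [Nat.add_comm, run]⟩

theorem seq (h : Runs O c s T fun s' => Runs O c' s' T' Q) :
    Runs O (.seq c c') s (T + T' + 1) Q := by
  obtain ⟨t, ht, s', ⟨t', ht', s'', hQ, h'⟩, h⟩ := h
  refine ⟨t + t' + 1, by omega, s'', hQ, fun K u => ?_⟩
  rw [show t + t' + 1 + u = (t + (t' + u)) + 1 by omega, run, h, h']

theorem instr_seq {o : Instr} (h : Runs O c (o.exec O s) T Q) :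
    Runs O (.seq (.instr o) c) s (T + 2) Q :=
  (seq (instr h)).of_le (by omega)

theorem ite (h : b.Holds O s → Runs O c s T Q) (h' : ¬ b.Holds O s → Runs O c' s T Q) :
    Runs O (.ite b c c') s (T + 1) Q := by
  by_cases hb : b.Holds O s
  · obtain ⟨t, ht, s', hQ, h⟩ := h hb
    refine ⟨t + 1, by omega, s', hQ, fun K u => ?_⟩
    rw [show t + 1 + u = (t + u) + 1 by omega, run, if_pos hb, h]
  · obtain ⟨t, ht, s', hQ, h⟩ := h' hb
    refine ⟨t + 1, by omega, s', hQ, fun K u => ?_⟩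
    rw [show t + 1 + u = (t + u) + 1 by omega, run, if_neg hb, h]

theorem while_loop {N : ℕ} {Inv : ℕ → Memory n → Prop}
    (hstep : ∀ m < N, ∀ s, Inv m s → b.Holds O s ∧ Runs O c s T (Inv (m + 1)))
    (hend : ∀ s, Inv N s → ¬ b.Holds O s) (d : ℕ) :
    ∀ m s, m + d = N → Inv m s → Runs O (.while b c) s (d * (T + 1) + 1) (Inv N) := by
  induction d with
  | zero =>
    intro m s hm hs
    obtain rfl : m = N := by omega
    refine ⟨1, by omega, s, hs, fun K u => ?_⟩
    rw [Nat.add_comm, run, if_neg (hend s hs)]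
  | succ d ih =>
    intro m s hm hs
    obtain ⟨hb, t, ht, s', hs', h⟩ := hstep m (by omega) s hs
    obtain ⟨t', ht', s'', hs'', h'⟩ := ih (m + 1) s' (by omega) hs'
    refine ⟨t + t' + 1, ?_, s'', hs'', fun K u => ?_⟩
    · rw [Nat.add_mul, Nat.one_mul]; omega
    · rw [show t + t' + 1 + u = (t + (t' + u)) + 1 by omega, run, if_pos hb, h, h']

theorem exists_done (h : Runs O c s T Q) : ∃ s', Q s' ∧ run O T [c] s = .done s' := by
  obtain ⟨t, ht, s', hQ, h⟩ := h
  refine ⟨s', hQ, ?_⟩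
  obtain ⟨u, rfl⟩ := Nat.exists_eq_add_of_le ht
  rw [h]
  -- Unused steps do no harm: an empty list of programs has halted whatever the remaining budget.
  cases u <;> rw [run]

end Runs

namespace Prog

/-- The program that does nothing. -/
def skip : Prog := .instr (.natCopy 0 0)

/-- Run `c` with counter `i` ranging over the numbers below counter `0`. -/
def forLoop (i : ℕ) (c : Prog) : Prog :=
  .seq (.instr (.natConst i 0)) (.while (.natLt i 0) (.seq c (.instr (.natSucc i))))

/-- The programs `c 0, …, c (l - 1)`, one after the other. -/
def repeated (c : ℕ → Prog) : ℕ → Prog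
  | 0 => skip
  | l + 1 => .seq (repeated c l) (c l)

end Prog

namespace Runs

variable {c : Prog} {s : Memory n} {T : ℕ} {Q : Memory n → Prop}

theorem skip (h : Q s) : Runs O .skip s 1 Q := by
  refine instr ?_
  have : (Instr.natCopy 0 0).exec O s = s := by
    simp [Instr.exec, Memory.setNat, Function.update_eq_self]
  rwa [this]

theorem repeated {c : ℕ → Prog} {l : ℕ} {Inv : ℕ → Memory n → Prop} (h0 : Inv 0 s)
    (hstep : ∀ j < l, ∀ s, Inv j s → Runs O (c j) s T (Inv (j + 1))) :
    Runs O (.repeated c l) s (l * (T + 1) + 1) (Inv l) := by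
  induction l with
  | zero => exact (skip h0).of_le (by omega)
  | succ l ih =>
    refine (seq ((ih fun j hj => hstep j (by omega)).post (hstep l (by omega)))).of_le ?_
    rw [Nat.add_mul, Nat.one_mul]
    omega

theorem forLoop {i : ℕ} (hi : i ≠ 0) {Inv : ℕ → Memory n → Prop} (hn : s.nat 0 = n)
    (h0 : Inv 0 (s.setNat i 0))
    (hstep : ∀ m < n, ∀ s, Inv m s → s.nat i = m → s.nat 0 = n → Runs O c s T fun s' =>
      s'.nat i = m ∧ s'.nat 0 = n ∧ Inv (m + 1) (s'.setNat i (m + 1))) :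
    Runs O (.forLoop i c) s (n * (T + 3) + 3) (Inv n) := by
  have hloop := while_loop (O := O) (N := n) (b := .natLt i 0) (T := T + 2)
    (c := .seq c (.instr (.natSucc i)))
    (Inv := fun m s => Inv m s ∧ s.nat i = m ∧ s.nat 0 = n)
    (fun m hm s hs => ⟨by simp only [Test.Holds]; omega,
      seq ((hstep m hm s hs.1 hs.2.1 hs.2.2).post fun s' hs' => instr (by
        simp only [Instr.exec, hs'.1]
        exact ⟨hs'.2.2, by simp [Memory.setNat], by simp [Memory.setNat, hi.symm, hs'.2.1]⟩))⟩)
    (fun s hs => by simp only [Test.Holds]; omega) n 0 (s.setNat i 0) (by omega)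
    ⟨h0, by simp [Memory.setNat], by simp [Memory.setNat, hi.symm, hn]⟩
  exact (seq (instr (o := .natConst i 0) (hloop.post fun s hs => hs.1))).of_le
    (by rw [show T + 2 + 1 = T + 3 from rfl]; omega)

end Runs

end Execution

/-! ### The algorithm

The program draws no random numbers: three runs of the local search, whose thresholds are shifted by
the factors `1`, `5 / 4` and `8 / 5`, take the place of a run with a random shift.

Counters: `0` holds `n`; `2`, `3`, `4` range over elements, `5` over passes and `6` over phases.
Real registers: `4` holds the threshold, `5` the initial threshold of the first run, `6` the number
two. Set registers: `0` holds the best set, `1` is for temporary use, `2 + j` holds the `j`-th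
solution, `2 + l + j` its value at the beginning of the phase, and `2 + 2 * l` the empty set. -/

namespace Prog

/-- No solution contains the element in counter `i`. -/
def freeTest (i : ℕ) : ℕ → Test
  -- A test that always holds.
  | 0 => .not (.natLt i i)
  | l + 1 => .and (freeTest i l) (.not (.mem i (2 + l)))

/-- Compute the values that decide whether the element in counter `3` can be added to the `j`-th
solution. -/
def prepareAdd (j : ℕ) : Prog :=
  .seq (.instr (.setCopy 1 (2 + j))) <|
  .seq (.instr (.value 0 1)) <|
  .seq (.instr (.setInsert 1 3)) <|
  .seq (.instr (.value 1 1)) <|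
  .instr (.realAdd 3 0 4)

/-- Try to add the element in counter `3` to the `j`-th solution. -/
def addStep (l j : ℕ) : Prog :=
  .seq (prepareAdd j) <|
  .ite (.and (freeTest 3 l) (.and (.feasible 1) (.not (.realLt 1 3))))
    (.instr (.setCopy (2 + j) 1)) skip

/-- Compute the values that decide whether the element in counter `2` can be replaced by those in
counters `3` and `4` in the `j`-th solution. -/
def prepareSwap (j : ℕ) : Prog :=
  .seq (.instr (.setCopy 1 (2 + j))) <|
  .seq (.instr (.setErase 1 2)) <|
  .seq (.instr (.value 0 1)) <|
  .seq (.instr (.setInsert 1 3)) <|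
  .seq (.instr (.value 1 1)) <|
  .seq (.instr (.setInsert 1 4)) <|
  .seq (.instr (.value 2 1)) <|
  .seq (.instr (.realAdd 3 0 4)) <|
  .instr (.realAdd 0 1 4)

/-- Try to replace the element in counter `2` by those in counters `3` and `4` in the `j`-th
solution. -/
def swapStep (l j : ℕ) : Prog :=
  .seq (prepareSwap j) <|
  .ite (.and (.and (.mem 2 (2 + j)) (.not (.mem 2 (2 + l + j))))
      (.and (.and (freeTest 3 l) (freeTest 4 l))
        -- This says that the two new elements are distinct.
        (.and (.not (.and (.not (.natLt 3 4)) (.not (.natLt 4 3))))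
          (.and (.feasible 1) (.and (.not (.realLt 1 3)) (.not (.realLt 2 0)))))))
    (.instr (.setCopy (2 + j) 1)) skip

/-- Try all moves once. -/
def pass (l : ℕ) : Prog :=
  .seq (forLoop 3 (repeated (addStep l) l))
    (forLoop 2 (forLoop 3 (forLoop 4 (repeated (swapStep l) l))))

/-- Local search with the threshold in register `4`. -/
def phase (l : ℕ) : Prog :=
  .seq (repeated (fun j => .instr (.setCopy (2 + l + j) (2 + j))) l)
    -- In all `n + 1` passes: at most `n` of them can change anything.
    (.seq (forLoop 5 (pass l)) (pass l))

/-- Replace the best set by the set in register `S` if that is better. -/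
def improve (S : ℕ) : Prog :=
  .seq (.instr (.value 0 0)) <|
  .seq (.instr (.value 1 S)) <|
  .ite (.realLt 0 1) (.instr (.setCopy 0 S)) skip

/-- A run whose initial threshold is `a / b` times the number in register `5`. -/
def localSearch (l a b : ℕ) : Prog :=
  .seq (repeated (fun j => .instr (.setCopy (2 + j) (2 + 2 * l))) l) <|
  .seq (.instr (.natConst 7 a)) <|
  .seq (.instr (.realOfNat 0 7)) <|
  .seq (.instr (.natConst 7 b)) <|
  .seq (.instr (.realOfNat 1 7)) <|
  .seq (.instr (.realDiv 0 0 1)) <|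
  .seq (.instr (.realMul 4 0 5)) <|
  .seq (.instr (.natConst 7 2)) <|
  .seq (.instr (.realOfNat 6 7)) <|
  .seq (forLoop 6 (.seq (phase l) (.instr (.realDiv 4 4 6)))) <|
  repeated (fun j => improve (2 + j)) l

/-- Make the best feasible set with at most one element the best set. -/
def bestSingleton (l : ℕ) : Prog :=
  forLoop 2 <|
  .seq (.instr (.setCopy 1 (2 + 2 * l))) <|
  .seq (.instr (.setInsert 1 2)) <|
  .ite (.feasible 1) (improve 1) skip

/-- The approximation algorithm, with `l` disjoint solutions. -/
def algorithm (l : ℕ) : Prog :=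
  .seq (bestSingleton l) <|
  .seq (.instr (.value 5 0)) <|
  .seq (localSearch l 1 1) <|
  .seq (localSearch l 5 4) <|
  localSearch l 8 5

end Prog

/-! ### Correctness and cost of single moves and passes -/

section Correctness

variable {n : ℕ} {l : ℕ}

/-- `s'` agrees with `s` on the counters below `a` or from `b` on, on the real registers from `r`
on, and on the set registers from `m` on and register `0`. -/
structure Keep (a b r m : ℕ) (s s' : Memory n) : Prop where
  nat : ∀ i, i < a ∨ b ≤ i → s'.nat i = s.nat i
  real : ∀ i, r ≤ i → s'.real i = s.real i
  set : ∀ S, S = 0 ∨ m ≤ S → s'.set S = s.set S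

namespace Keep

variable {a b r m a' b' r' m' : ℕ} {s s' s'' : Memory n}

theorem refl (s : Memory n) : Keep a b r m s s := ⟨fun _ _ => rfl, fun _ _ => rfl, fun _ _ => rfl⟩

theorem trans (h : Keep a b r m s s') (h' : Keep a b r m s' s'') : Keep a b r m s s'' :=
  ⟨fun i hi => (h'.nat i hi).trans (h.nat i hi), fun i hi => (h'.real i hi).trans (h.real i hi),
    fun S hS => (h'.set S hS).trans (h.set S hS)⟩

theorem mono (h : Keep a b r m s s') (ha : a' ≤ a) (hb : b ≤ b') (hr : r ≤ r') (hm : m ≤ m') :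
    Keep a' b' r' m' s s' :=
  ⟨fun i hi => h.nat i (by omega), fun i hi => h.real i (by omega), fun S hS => h.set S (by omega)⟩

theorem setNat (s : Memory n) {i : ℕ} (x : ℕ) (ha : a ≤ i) (hb : i < b) :
    Keep a b r m s (s.setNat i x) :=
  ⟨fun j hj => by simp [Memory.setNat, Function.update_of_ne (show j ≠ i by omega)],
    fun _ _ => rfl, fun _ _ => rfl⟩

end Keep

/-- The solutions. -/
def Memory.sol (l : ℕ) (s : Memory n) : Fin l → Finset (Fin n) := fun j => s.set (2 + j)

/-- The solutions at the beginning of the phase. -/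
def Memory.start (l : ℕ) (s : Memory n) : Fin l → Finset (Fin n) := fun j => s.set (2 + l + j)

theorem Keep.start_eq {a b r : ℕ} {s s' : Memory n} (h : Keep a b r (2 + l) s s') :
    s'.start l = s.start l := funext fun j => h.set _ (by omega)

variable {O : Oracles n}

theorem freeTest_holds {s : Memory n} {i : ℕ} (hi : s.nat i < n) :
    (Prog.freeTest i l).Holds O s ↔ IsFree (s.sol l) ⟨s.nat i, hi⟩ := by
  have : (Prog.freeTest i l).Holds O s ↔ ∀ j < l, (⟨s.nat i, hi⟩ : Fin n) ∉ s.set (2 + j) := by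
    induction l with
    | zero => simp [Prog.freeTest, Test.Holds]
    | succ l ih =>
      simp only [Prog.freeTest, Test.Holds, ih, hi, exists_true_left, Nat.lt_succ_iff]
      constructor
      · rintro ⟨h1, h2⟩ j hj
        rcases hj.lt_or_eq with h | rfl
        · exact h1 j h
        · exact h2
      · exact fun h => ⟨fun j hj => h j hj.le, h l le_rfl⟩
  rw [this]
  exact ⟨fun h j => h j j.2, fun h j hj => h ⟨j, hj⟩⟩

/-- The moves that are possible with the current threshold. -/
abbrev MoveAt (O : Oracles n) (l : ℕ) (s : Memory n) :=
  Move O.feas O.f (s.real 4) (s.start l)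

theorem Keep.moveAt_eq {a b : ℕ} {s s' : Memory n} (h : Keep a b 4 (2 + l) s s') :
    MoveAt O l s' = MoveAt O l s := by
  rw [MoveAt, h.start_eq, h.real 4 le_rfl]

theorem sol_setSet (s : Memory n) (j : Fin l) (X : Finset (Fin n)) :
    (s.setSet (2 + j) X).sol l = Function.update (s.sol l) j X := by
  funext i
  by_cases h : i = j
  · subst h; simp [Memory.sol, Memory.setSet]
  · have : (i : ℕ) ≠ j := fun h' => h (Fin.ext h')
    simp [Memory.sol, Memory.setSet, h, this]

theorem prepareAdd_runs (s : Memory n) (j : ℕ) (hb : s.nat 3 < n) :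
    Runs O (.prepareAdd j) s 9 fun s' => Keep 5 5 4 2 s s' ∧
      s'.set 1 = insert ⟨s.nat 3, hb⟩ (s.set (2 + j)) ∧
      s'.real 1 = O.f (insert ⟨s.nat 3, hb⟩ (s.set (2 + j))) ∧
      s'.real 3 = O.f (s.set (2 + j)) + s.real 4 := by
  refine Runs.of_le (Runs.instr_seq (Runs.instr_seq (Runs.instr_seq (Runs.instr_seq
    (Runs.instr ⟨⟨fun i _ => ?_, fun i hi => ?_, fun S hS => ?_⟩, ?_, ?_, ?_⟩))))) le_rfl
  · simp [Instr.exec, Memory.setSet, Memory.setReal, hb]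
  · simp [Instr.exec, Memory.setSet, Memory.setReal, hb,
      Function.update_of_ne (show i ≠ 0 by omega), Function.update_of_ne (show i ≠ 1 by omega),
      Function.update_of_ne (show i ≠ 3 by omega)]
  · simp [Instr.exec, Memory.setSet, Memory.setReal, hb,
      Function.update_of_ne (show S ≠ 1 by omega)]
  · simp [Instr.exec, Memory.setSet, Memory.setReal, hb]
  · simp [Instr.exec, Memory.setSet, Memory.setReal, hb]
  · simp [Instr.exec, Memory.setSet, Memory.setReal, hb]

theorem prepareSwap_runs (s : Memory n) (j : ℕ) (ha : s.nat 2 < n) (hb : s.nat 3 < n)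
    (hc : s.nat 4 < n) :
    Runs O (.prepareSwap j) s 17 fun s' => Keep 5 5 4 2 s s' ∧
      s'.set 1 = insert ⟨s.nat 4, hc⟩ (insert ⟨s.nat 3, hb⟩
        ((s.set (2 + j)).erase ⟨s.nat 2, ha⟩)) ∧
      s'.real 1 = O.f (insert ⟨s.nat 3, hb⟩ ((s.set (2 + j)).erase ⟨s.nat 2, ha⟩)) ∧
      s'.real 2 = O.f (insert ⟨s.nat 4, hc⟩ (insert ⟨s.nat 3, hb⟩
        ((s.set (2 + j)).erase ⟨s.nat 2, ha⟩))) ∧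
      s'.real 3 = O.f ((s.set (2 + j)).erase ⟨s.nat 2, ha⟩) + s.real 4 ∧
      s'.real 0 = O.f (insert ⟨s.nat 3, hb⟩ ((s.set (2 + j)).erase ⟨s.nat 2, ha⟩)) + s.real 4 := by
  refine Runs.of_le (Runs.instr_seq (Runs.instr_seq (Runs.instr_seq (Runs.instr_seq
    (Runs.instr_seq (Runs.instr_seq (Runs.instr_seq (Runs.instr_seq
    (Runs.instr ⟨⟨fun i _ => ?_, fun i hi => ?_, fun S hS => ?_⟩, ?_, ?_, ?_, ?_, ?_⟩)))))))))
    le_rfl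
  · simp [Instr.exec, Memory.setSet, Memory.setReal, ha, hb, hc]
  · simp [Instr.exec, Memory.setSet, Memory.setReal, ha, hb, hc,
      Function.update_of_ne (show i ≠ 0 by omega), Function.update_of_ne (show i ≠ 1 by omega),
      Function.update_of_ne (show i ≠ 2 by omega), Function.update_of_ne (show i ≠ 3 by omega)]
  · simp [Instr.exec, Memory.setSet, Memory.setReal, ha, hb, hc,
      Function.update_of_ne (show S ≠ 1 by omega)]
  all_goals simp [Instr.exec, Memory.setSet, Memory.setReal, ha, hb, hc]

theorem Keep.sol_eq {a b r : ℕ} {s s' : Memory n} (h : Keep a b r 2 s s') :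
    s'.sol l = s.sol l := funext fun j => h.set _ (by omega)

theorem Keep.setSet (s : Memory n) (j : Fin l) (X : Finset (Fin n)) {a b r : ℕ} :
    Keep a b r (2 + l) s (s.setSet (2 + j) X) :=
  ⟨fun _ _ => rfl, fun _ _ => rfl, fun S hS => by
    simp [Memory.setSet, Function.update_of_ne (show S ≠ 2 + j by omega)]⟩

theorem addStep_runs (s : Memory n) (j : Fin l) (hb : s.nat 3 < n) :
    Runs O (.addStep l j) s 12 fun s' => Keep 5 5 4 (2 + l) s s' ∧
      Progress (MoveAt O l s) (¬ CanAdd O.feas O.f (s.real 4) (s.sol l) j ⟨s.nat 3, hb⟩)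
        (s.sol l) (s'.sol l) := by
  refine (Runs.seq ((prepareAdd_runs s j hb).post fun s₁ ⟨hk, h1, hr1, hr3⟩ =>
    Runs.ite (T := 1) (fun h => ?_) fun h => ?_)).of_le le_rfl
  all_goals
    have hn3 : s₁.nat 3 = s.nat 3 := hk.nat 3 (by omega)
    have hb1 : s₁.nat 3 < n := by omega
    have hfin : (⟨s₁.nat 3, hb1⟩ : Fin n) = ⟨s.nat 3, hb⟩ := Fin.ext hn3
    simp only [Test.Holds, freeTest_holds hb1, hfin, hk.sol_eq, h1, hr1, hr3, not_lt] at h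
  · refine Runs.instr ⟨(hk.mono le_rfl le_rfl le_rfl (by omega)).trans (.setSet _ _ _), .inr ?_⟩
    rw [Instr.exec, sol_setSet, hk.sol_eq, h1]
    exact .single (.add ⟨h.1, h.2.1, h.2.2⟩)
  · refine Runs.skip ⟨hk.mono le_rfl le_rfl le_rfl (by omega), .inl ⟨hk.sol_eq, ?_⟩⟩
    exact fun hadd => h ⟨hadd.1, hadd.2.1, hadd.2.2⟩

theorem swapStep_runs (s : Memory n) (j : Fin l) (ha : s.nat 2 < n) (hb : s.nat 3 < n)
    (hc : s.nat 4 < n) :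
    Runs O (.swapStep l j) s 20 fun s' => Keep 5 5 4 (2 + l) s s' ∧
      Progress (MoveAt O l s) (¬ CanSwap O.feas O.f (s.real 4) (s.start l) (s.sol l) j
        ⟨s.nat 2, ha⟩ ⟨s.nat 3, hb⟩ ⟨s.nat 4, hc⟩) (s.sol l) (s'.sol l) := by
  refine (Runs.seq ((prepareSwap_runs s j ha hb hc).post fun s₁ ⟨hk, h1, hr1, hr2, hr3, hr0⟩ =>
    Runs.ite (T := 1) (fun h => ?_) fun h => ?_)).of_le le_rfl
  all_goals
    have hn2 : s₁.nat 2 = s.nat 2 := hk.nat 2 (by omega)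
    have hn3 : s₁.nat 3 = s.nat 3 := hk.nat 3 (by omega)
    have hn4 : s₁.nat 4 = s.nat 4 := hk.nat 4 (by omega)
    have ha1 : s₁.nat 2 < n := by omega
    have hb1 : s₁.nat 3 < n := by omega
    have hc1 : s₁.nat 4 < n := by omega
    have hfa : (⟨s₁.nat 2, ha1⟩ : Fin n) = ⟨s.nat 2, ha⟩ := Fin.ext hn2
    have hP : s₁.set (2 + l + j) = s.set (2 + l + j) := hk.set _ (by omega)
    have hS : s₁.set (2 + j) = s.set (2 + j) := hk.set _ (by omega)
    have hne : ¬(s.nat 4 ≤ s.nat 3 ∧ s.nat 3 ≤ s.nat 4) ↔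
        (⟨s.nat 3, hb⟩ : Fin n) ≠ ⟨s.nat 4, hc⟩ := by
      rw [Ne, Fin.mk.injEq]; omega
    simp only [Test.Holds, freeTest_holds hb1, freeTest_holds hc1, hfa, hk.sol_eq,
      ha1, exists_true_left, h1, hr0, hr1, hr2, hr3, hn3, hn4, hne, hP, hS, not_lt] at h
  · refine Runs.instr ⟨(hk.mono le_rfl le_rfl le_rfl (by omega)).trans (.setSet _ _ _), .inr ?_⟩
    rw [Instr.exec, sol_setSet, hk.sol_eq, h1]
    obtain ⟨⟨h1, h2⟩, ⟨h3, h4⟩, h5, h6, h7, h8⟩ := h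
    exact .single (.swap ⟨h1, h2, h3, h4, h5, h6, h7, h8⟩)
  · refine Runs.skip ⟨hk.mono le_rfl le_rfl le_rfl (by omega), .inl ⟨hk.sol_eq, ?_⟩⟩
    exact fun ⟨h1, h2, h3, h4, h5, h6, h7, h8⟩ => h ⟨⟨h1, h2⟩, ⟨h3, h4⟩, h5, h6, h7, h8⟩

/-- A loop that leaves the solutions unchanged has checked every candidate against the same
solutions, so all its negative findings hold simultaneously. The body may use the counters above
`i`, which allows nesting. -/
theorem forLoop_progress {c : Prog} {T i : ℕ} (hi : 2 ≤ i) (hi' : i < 5) (s : Memory n)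
    (hn : s.nat 0 = n) {N : ℕ → (Fin l → Finset (Fin n)) → Prop}
    (hstep : ∀ m < n, ∀ s₁, Keep i 5 4 (2 + l) s s₁ → s₁.nat i = m → Runs O c s₁ T fun s₂ =>
      Keep (i + 1) 5 4 (2 + l) s₁ s₂ ∧
        Progress (MoveAt O l s) (N m (s₁.sol l)) (s₁.sol l) (s₂.sol l)) :
    Runs O (.forLoop i c) s (n * (T + 3) + 3) fun s' => Keep i 5 4 (2 + l) s s' ∧
      Progress (MoveAt O l s) (∀ m < n, N m (s.sol l)) (s.sol l) (s'.sol l) := by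
  refine Runs.forLoop (Inv := fun m s' => Keep i 5 4 (2 + l) s s' ∧
    Progress (MoveAt O l s) (∀ m' < m, N m' (s.sol l)) (s.sol l) (s'.sol l)) (by omega) hn
    ⟨.setNat _ _ le_rfl hi', .refl (by simp) _⟩ ?_
  rintro m hm s₁ ⟨hk, hp⟩ him h0
  refine (hstep m hm s₁ hk him).post fun s₂ ⟨hk', hp'⟩ => ?_
  refine ⟨(hk'.nat i (by omega)).trans him, (hk'.nat 0 (by omega)).trans h0,
    (hk.trans (hk'.mono (by omega) le_rfl le_rfl le_rfl)).trans (.setNat _ _ le_rfl hi'),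
    hp.trans hp' fun heq h h' m' hm' => ?_⟩
  rcases (Nat.lt_succ_iff.1 hm').lt_or_eq with h1 | rfl
  · exact h m' h1
  · exact heq ▸ h'

theorem repeated_progress {c : ℕ → Prog} {T : ℕ} (s : Memory n)
    {N : Fin l → (Fin l → Finset (Fin n)) → Prop}
    (hstep : ∀ j : Fin l, ∀ s₁, Keep 5 5 4 (2 + l) s s₁ → Runs O (c j) s₁ T fun s₂ =>
      Keep 5 5 4 (2 + l) s₁ s₂ ∧
        Progress (MoveAt O l s) (N j (s₁.sol l)) (s₁.sol l) (s₂.sol l)) :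
    Runs O (.repeated c l) s (l * (T + 1) + 1) fun s' => Keep 5 5 4 (2 + l) s s' ∧
      Progress (MoveAt O l s) (∀ j, N j (s.sol l)) (s.sol l) (s'.sol l) := by
  refine (Runs.repeated (Inv := fun m s' => Keep 5 5 4 (2 + l) s s' ∧
    Progress (MoveAt O l s) (∀ j : Fin l, j < m → N j (s.sol l)) (s.sol l) (s'.sol l))
    ⟨.refl s, .refl (by simp) _⟩ ?_).post fun s' ⟨hk, hp⟩ => ⟨hk, ?_⟩
  · rintro j hj s₁ ⟨hk, hp⟩
    refine (hstep ⟨j, hj⟩ s₁ hk).post fun s₂ ⟨hk', hp'⟩ =>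
      ⟨hk.trans hk', hp.trans hp' fun heq h h' i hi => ?_⟩
    rcases (Nat.lt_succ_iff.1 hi).lt_or_eq with h1 | h1
    · exact h i h1
    · obtain rfl : i = ⟨j, hj⟩ := Fin.ext h1
      exact heq ▸ h'
  · simpa using hp

theorem addSteps_runs (s : Memory n) (hn : s.nat 0 = n) :
    Runs O (.forLoop 3 (.repeated (Prog.addStep l) l)) s (n * (l * 13 + 4) + 3) fun s' =>
      Keep 3 5 4 (2 + l) s s' ∧ Progress (MoveAt O l s)
        (∀ j b, ¬ CanAdd O.feas O.f (s.real 4) (s.sol l) j b) (s.sol l) (s'.sol l) := by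
  refine (forLoop_progress (l := l) (by norm_num) (by norm_num) s hn
    (N := fun m σ => ∀ j, ∀ h : m < n, ¬ CanAdd O.feas O.f (s.real 4) σ j ⟨m, h⟩)
    fun m hm s₁ hk hm₁ => (repeated_progress (T := 12) s₁
      (N := fun j σ => ∀ h : m < n, ¬ CanAdd O.feas O.f (s.real 4) σ j ⟨m, h⟩)
      fun j s₂ hk₂ => ?_).post ?_).post ?_
  · have h3 : s₂.nat 3 = m := (hk₂.nat 3 (by omega)).trans hm₁
    refine (addStep_runs s₂ j (by omega)).post fun s₃ ⟨hk₃, hp⟩ => ⟨hk₃, ?_⟩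
    rw [hk₂.moveAt_eq] at hp
    rw [hk₂.real 4 le_rfl, hk.real 4 le_rfl] at hp
    subst h3
    exact hp.imp (fun h => ⟨h.1, fun _ => h.2⟩) id
  · exact fun s₂ ⟨hk₂, hp⟩ => ⟨hk₂.mono (by omega) le_rfl le_rfl le_rfl, hk.moveAt_eq ▸ hp⟩
  · exact fun s' ⟨hk, hp⟩ => ⟨hk, hp.imp (fun h => ⟨h.1, fun j b => h.2 b b.2 j b.2⟩) id⟩

theorem swapSteps_runs (s : Memory n) (hn : s.nat 0 = n) :
    Runs O (.forLoop 2 (.forLoop 3 (.forLoop 4 (.repeated (Prog.swapStep l) l)))) s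
      (n * (n * (n * (l * 21 + 4) + 6) + 6) + 3) fun s' =>
      Keep 2 5 4 (2 + l) s s' ∧ Progress (MoveAt O l s)
        (∀ j a b c, ¬ CanSwap O.feas O.f (s.real 4) (s.start l) (s.sol l) j a b c)
        (s.sol l) (s'.sol l) := by
  let N : ℕ → ℕ → ℕ → Fin l → (Fin l → Finset (Fin n)) → Prop := fun a b c j σ =>
    ∀ (ha : a < n) (hb : b < n) (hc : c < n),
      ¬ CanSwap O.feas O.f (s.real 4) (s.start l) σ j ⟨a, ha⟩ ⟨b, hb⟩ ⟨c, hc⟩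
  refine (forLoop_progress (l := l) (by norm_num) (by norm_num) s hn
    (N := fun a σ => ∀ b < n, ∀ c < n, ∀ j, N a b c j σ)
    fun a ha s₁ hk₁ ha₁ => ?_).post ?_
  · refine (forLoop_progress (l := l) (by norm_num) (by norm_num) s₁
      ((hk₁.nat 0 (by omega)).trans hn) (N := fun b σ => ∀ c < n, ∀ j, N a b c j σ)
      fun b hb s₂ hk₂ hb₂ => ?_).post fun s' ⟨hk, hp⟩ => ⟨hk, hk₁.moveAt_eq ▸ hp⟩
    refine (forLoop_progress (l := l) (by norm_num) (by norm_num) s₂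
      ((hk₂.nat 0 (by omega)).trans ((hk₁.nat 0 (by omega)).trans hn))
      (N := fun c σ => ∀ j, N a b c j σ)
      fun c hc s₃ hk₃ hc₃ => ?_).post fun s' ⟨hk, hp⟩ => ⟨hk, hk₂.moveAt_eq ▸ hp⟩
    refine (repeated_progress (T := 20) s₃ (N := N a b c) fun j s₄ hk₄ => ?_).post
      fun s' ⟨hk, hp⟩ => ⟨hk, hk₃.moveAt_eq ▸ hp⟩
    have h2 : s₄.nat 2 = a := by
      rw [hk₄.nat 2 (by omega), hk₃.nat 2 (by omega), hk₂.nat 2 (by omega), ha₁]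
    have h3 : s₄.nat 3 = b := by rw [hk₄.nat 3 (by omega), hk₃.nat 3 (by omega), hb₂]
    have h4 : s₄.nat 4 = c := by rw [hk₄.nat 4 (by omega), hc₃]
    refine (swapStep_runs s₄ j (by omega) (by omega) (by omega)).post fun s' ⟨hk, hp⟩ => ⟨hk, ?_⟩
    rw [hk₄.moveAt_eq, hk₄.real 4 le_rfl, hk₃.real 4 le_rfl, hk₂.real 4 le_rfl,
      hk₁.real 4 le_rfl, hk₄.start_eq, hk₃.start_eq, hk₂.start_eq, hk₁.start_eq] at hp
    subst h2 h3 h4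
    exact hp.imp (fun h => ⟨h.1, fun _ _ _ => h.2⟩) id
  · exact fun s' ⟨hk, hp⟩ => ⟨hk, hp.imp (fun h => ⟨h.1, fun j a b c =>
      h.2 a a.2 b b.2 c c.2 j a.2 b.2 c.2⟩) id⟩

/-- A bound for the number of steps of a pass. -/
def passTime (l n : ℕ) : ℕ :=
  (n * (l * 13 + 4) + 3) + (n * (n * (n * (l * 21 + 4) + 6) + 6) + 3) + 1

theorem pass_runs (s : Memory n) (hn : s.nat 0 = n) :
    Runs O (.pass l) s (passTime l n) fun s' => Keep 2 5 4 (2 + l) s s' ∧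
      Progress (MoveAt O l s) (IsStuck O.feas O.f (s.real 4) (s.start l) (s.sol l))
        (s.sol l) (s'.sol l) := by
  refine Runs.seq ((addSteps_runs s hn).post fun s₁ ⟨hk₁, hp₁⟩ => ?_)
  refine (swapSteps_runs s₁ ((hk₁.nat 0 (by omega)).trans hn)).post fun s₂ ⟨hk₂, hp₂⟩ => ?_
  rw [hk₁.moveAt_eq, hk₁.real 4 le_rfl, hk₁.start_eq] at hp₂
  exact ⟨(hk₁.mono (by omega) le_rfl le_rfl le_rfl).trans hk₂,
    hp₁.trans hp₂ fun heq h h' => ⟨h, heq ▸ h'⟩⟩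

end Correctness

/-! ### Correctness and cost of phases, runs and the whole algorithm -/

section Correctness

variable {n : ℕ} {l : ℕ} {O : Oracles n}

/-- A bound for the number of steps of a phase. -/
def phaseTime (l n : ℕ) : ℕ :=
  (l * 2 + 1) + ((n * (passTime l n + 3) + 3) + passTime l n + 1) + 1

/-- A pass without change certifies that no move is possible. Any other pass increases the total
size of the disjoint solutions, which never exceeds `n`. -/
theorem phase_runs (hf : IsSubmodular O.f) (s : Memory n) (hn : s.nat 0 = n)
    (hdisj : Pairwise fun i j => Disjoint (s.sol l i) (s.sol l j))
    (hfeas : ∀ j, O.feas (s.sol l j)) :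
    Runs O (.phase l) s (phaseTime l n) fun s' => Keep 2 6 4 (2 + 2 * l) s s' ∧
      IsPhase O.feas O.f (s.real 4) (s.sol l) (s'.sol l) := by
  refine Runs.seq ((Runs.repeated (T := 1) (Inv := fun m s' => Keep 5 5 4 (2 + 2 * l) s s' ∧
    (∀ j < l, s'.set (2 + j) = s.set (2 + j)) ∧ ∀ j < m, s'.set (2 + l + j) = s.set (2 + j))
    ⟨.refl s, by simp, by simp⟩ ?_).post ?_)
  · rintro j hj s₁ ⟨hk, hsol, hstart⟩
    refine Runs.instr ⟨hk.trans ⟨fun _ _ => rfl, fun _ _ => rfl, fun S hS => ?_⟩,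
      fun i hi => ?_, fun i hi => ?_⟩
    · simp [Instr.exec, Memory.setSet, Function.update_of_ne (show S ≠ 2 + l + j by omega)]
    · simp only [Instr.exec, Memory.setSet,
        Function.update_of_ne (show 2 + i ≠ 2 + l + j by omega)]
      exact hsol i hi
    · by_cases hij : i = j
      · subst hij
        simp only [Instr.exec, Memory.setSet, Function.update_self]
        exact hsol i hj
      · simp only [Instr.exec, Memory.setSet,
          Function.update_of_ne (show 2 + l + i ≠ 2 + l + j by omega)]
        exact hstart i (by omega)
  rintro s₁ ⟨hk₁, hsol₁, hstart₁⟩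
  replace hsol₁ : s₁.sol l = s.sol l := funext fun j => hsol₁ j j.2
  replace hstart₁ : s₁.start l = s.sol l := funext fun j => hstart₁ j j.2
  have hn₁ : s₁.nat 0 = n := (hk₁.nat 0 (by omega)).trans hn
  have hτ : s₁.real 4 = s.real 4 := hk₁.real 4 le_rfl
  have hmove : MoveAt O l s₁ = Move O.feas O.f (s.real 4) (s.sol l) := by
    rw [MoveAt, hτ, hstart₁]
  let Good := IsGood O.feas O.f (s.real 4) (s.sol l)
  let Stuck := IsStuck O.feas O.f (s.real 4) (s.sol l)
  have hpass : ∀ s₂ : Memory n, Keep 2 6 4 (2 + l) s₁ s₂ → Runs O (.pass l) s₂ (passTime l n)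
      fun s₃ => Keep 2 5 4 (2 + l) s₂ s₃ ∧
        Progress (Move O.feas O.f (s.real 4) (s.sol l)) (Stuck (s₂.sol l))
          (s₂.sol l) (s₃.sol l) := by
    intro s₂ hk
    refine (pass_runs s₂ ((hk.nat 0 (by omega)).trans hn₁)).post fun s₃ ⟨hk', hp⟩ => ⟨hk', ?_⟩
    rw [hk.moveAt_eq, hmove, hk.real 4 le_rfl, hτ, hk.start_eq, hstart₁] at hp
    exact hp
  refine Runs.seq ((Runs.forLoop (Inv := fun m s' => Keep 2 6 4 (2 + l) s₁ s' ∧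
    Good (s'.sol l) ∧ (Stuck (s'.sol l) ∨ m ≤ ∑ j, (s'.sol l j).card)) (by norm_num) hn₁
    ⟨.setNat _ _ (by norm_num) (by norm_num), ?_, .inr (Nat.zero_le _)⟩ ?_).post ?_)
  · show Good (s₁.sol l)
    rw [hsol₁]
    exact ⟨hdisj, hfeas, fun j => .self⟩
  · rintro m hm s₂ ⟨hk₂, hgood, hs⟩ h5 h0
    refine (hpass s₂ hk₂).post fun s₃ ⟨hk₃, hp⟩ => ⟨(hk₃.nat 5 (by omega)).trans h5,
      (hk₃.nat 0 (by omega)).trans h0,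
      (hk₂.trans (hk₃.mono le_rfl (by omega) le_rfl le_rfl)).trans
        (.setNat _ _ (by norm_num) (by norm_num)), ?_⟩
    show Good (s₃.sol l) ∧ (Stuck (s₃.sol l) ∨ m + 1 ≤ ∑ j, (s₃.sol l j).card)
    rcases hp with ⟨heq, h⟩ | h
    · rw [heq]
      exact ⟨hgood, .inl h⟩
    · refine ⟨isGood_of_transGen hf h hgood, .inr ?_⟩
      have := sum_card_lt_of_transGen h
      have := hs.resolve_left fun hst => hst.not_transGen h
      omega
  · rintro s₂ ⟨hk₂, hgood, hs⟩
    refine (hpass s₂ hk₂).post fun s₃ ⟨hk₃, hp⟩ => ⟨(hk₁.mono (by omega) (by omega) le_rfl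
      le_rfl).trans ((hk₂.trans (hk₃.mono le_rfl (by omega) le_rfl le_rfl)).mono le_rfl le_rfl
      le_rfl (by omega)), ?_⟩
    rcases hp with ⟨heq, h⟩ | h
    · rw [heq]
      exact ⟨hgood.disjoint, hgood.feasible, hgood.steep, h.1, h.2⟩
    -- If even the last pass made a move, the solutions would contain more than `n` elements in
    -- total.
    · exfalso
      have h1 := sum_card_lt_of_transGen h
      have h2 := hs.resolve_left fun hst => hst.not_transGen h
      have h3 := (isGood_of_transGen hf h hgood).sum_card_le
      omega

theorem improve_runs (s : Memory n) (S : ℕ) :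
    Runs O (.improve S) s 6 fun s' => s'.nat = s.nat ∧ (∀ r, 2 ≤ r → s'.real r = s.real r) ∧
      (∀ S', S' ≠ 0 → s'.set S' = s.set S') ∧ (s'.set 0 = s.set 0 ∨ s'.set 0 = s.set S) ∧
      O.f (s.set 0) ≤ O.f (s'.set 0) ∧ O.f (s.set S) ≤ O.f (s'.set 0) := by
  have hreal : ∀ (x y : ℝ) (r : ℕ), 2 ≤ r → ((s.setReal 0 x).setReal 1 y).real r = s.real r :=
    fun x y r hr => by
      simp [Memory.setReal, Function.update_of_ne (show r ≠ 0 by omega),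
        Function.update_of_ne (show r ≠ 1 by omega)]
  refine Runs.of_le (Runs.instr_seq (Runs.instr_seq (Runs.ite (fun h => Runs.instr ?_)
    fun h => Runs.skip ?_))) le_rfl
  all_goals
    simp only [Test.Holds, Instr.exec, Memory.setReal, Function.update_self, ne_eq, zero_ne_one,
      not_false_eq_true, Function.update_of_ne, not_lt] at h
  · refine ⟨rfl, hreal _ _, fun S' hS' => ?_, .inr ?_, ?_, ?_⟩
    · simp [Instr.exec, Memory.setSet, Memory.setReal, hS']
    · simp [Instr.exec, Memory.setSet, Memory.setReal]
    · simpa [Instr.exec, Memory.setSet, Memory.setReal] using h.le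
    · simp [Instr.exec, Memory.setSet, Memory.setReal]
  · exact ⟨rfl, hreal _ _, fun S' hS' => rfl, .inl rfl, le_rfl, h⟩

/-- A bound for the number of steps of `localSearch`. -/
def localSearchTime (l n : ℕ) : ℕ :=
  (l * 2 + 1) + (((n * (phaseTime l n + 2 + 3) + 3) + (l * 7 + 1) + 1) + 16) + 1

theorem localSearch_runs (hf : IsSubmodular O.f) (hempty : O.feas ∅) (a b : ℕ) (s : Memory n)
    (hn : s.nat 0 = n) (hs : s.set (2 + 2 * l) = ∅) (hs0 : O.feas (s.set 0)) :
    Runs O (.localSearch l a b) s (localSearchTime l n) fun s' => s'.nat 0 = n ∧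
      s'.set (2 + 2 * l) = ∅ ∧ O.feas (s'.set 0) ∧ s'.real 5 = s.real 5 ∧
      O.f (s.set 0) ≤ O.f (s'.set 0) ∧
      ∃ σ : ℕ → Fin l → Finset (Fin n), IsRun O.feas O.f ((a : ℝ) / b * s.real 5) σ ∧
        ∀ j, O.f (σ n j) ≤ O.f (s'.set 0) := by
  refine Runs.seq ((Runs.repeated (T := 1) (Inv := fun m s' => Keep 8 8 0 (2 + 2 * l) s s' ∧
    ∀ j < m, s'.set (2 + j) = ∅) ⟨.refl s, by simp⟩ ?_).post ?_)
  · rintro j hj s₁ ⟨hk, hsol⟩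
    refine Runs.instr ⟨hk.trans ⟨fun _ _ => rfl, fun _ _ => rfl, fun S hS => ?_⟩, fun i hi => ?_⟩
    · simp [Instr.exec, Memory.setSet, Function.update_of_ne (show S ≠ 2 + j by omega)]
    · by_cases hij : i = j
      · subst hij
        simp only [Instr.exec, Memory.setSet, Function.update_self]
        rw [hk.set _ (by omega), hs]
      · simp only [Instr.exec, Memory.setSet,
          Function.update_of_ne (show 2 + i ≠ 2 + j by omega)]
        exact hsol i (by omega)
  rintro s₁ ⟨hk₁, hsol₁⟩
  refine Runs.of_le (Runs.instr_seq (Runs.instr_seq (Runs.instr_seq (Runs.instr_seq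
    (Runs.instr_seq (Runs.instr_seq (Runs.instr_seq (Runs.instr_seq ?_)))))))) le_rfl
  generalize hs₂ : Instr.exec O _ (Instr.realOfNat 6 7) = s₂
  obtain ⟨hset₂, hnat₂, h4, h5, h6⟩ : s₂.set = s₁.set ∧ s₂.nat 0 = s₁.nat 0 ∧
      s₂.real 4 = (a : ℝ) / b * s₁.real 5 ∧ s₂.real 5 = s₁.real 5 ∧ s₂.real 6 = 2 := by
    subst hs₂
    simp [Instr.exec, Memory.setNat, Memory.setReal]
  rw [hk₁.real 5 (by omega)] at h4 h5
  have hn₂ : s₂.nat 0 = n := by rw [hnat₂, hk₁.nat 0 (by omega), hn]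
  have hsol₂ : ∀ j, s₂.sol l j = ∅ := fun j => by rw [Memory.sol, hset₂]; exact hsol₁ j j.2
  have hset0 : ∀ S, S = 0 ∨ 2 + 2 * l ≤ S → s₂.set S = s.set S := fun S hS => by
    rw [hset₂, hk₁.set S hS]
  set c := (a : ℝ) / b * s.real 5 with hc
  refine Runs.seq ((Runs.forLoop (T := phaseTime l n + 2) (Inv := fun m s' =>
    Keep 2 7 5 (2 + 2 * l) s₂ s' ∧ s'.real 4 = c / 2 ^ m ∧
      ∃ σ : ℕ → Fin l → Finset (Fin n), (∀ j, σ 0 j = ∅) ∧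
        (∀ t < m, IsPhase O.feas O.f (c / 2 ^ t) (σ t) (σ (t + 1))) ∧ s'.sol l = σ m)
    (by norm_num) hn₂ ⟨.setNat _ _ (by norm_num) (by norm_num), by simpa [Memory.setNat] using h4,
      fun _ => s₂.sol l, hsol₂, by simp, rfl⟩ ?_).post ?_)
  · rintro m hm s₃ ⟨hk₃, h4₃, σ, hσ0, hσ, hsol₃⟩ h6₃ hn₃
    have hgood := disjoint_and_feasible hempty hσ0 hσ
    refine (Runs.seq ((phase_runs (l := l) hf s₃ hn₃ (by rw [hsol₃]; exact hgood.1)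
      (by rw [hsol₃]; exact hgood.2)).post fun s₄ ⟨hk₄, hp⟩ => Runs.instr ?_)).of_le le_rfl
    rw [hsol₃, h4₃] at hp
    have h4₄ : s₄.real 4 = c / 2 ^ m := (hk₄.real 4 le_rfl).trans h4₃
    have h6₄ : s₄.real 6 = 2 := by rw [hk₄.real 6 (by omega), hk₃.real 6 (by omega), h6]
    refine ⟨(hk₄.nat 6 (by omega)).trans h6₃, (hk₄.nat 0 (by omega)).trans hn₃, ?_, ?_,
      -- The history of the run, extended by the result of the phase just completed.
      fun t => if t ≤ m then σ t else s₄.sol l, by simpa using hσ0, fun t ht => ?_, ?_⟩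
    · have hdiv : Keep 2 7 5 (2 + 2 * l) s₄ (Instr.exec O s₄ (.realDiv 4 4 6)) :=
        ⟨fun _ _ => rfl, fun i hi => by
          simp [Instr.exec, Memory.setReal, Function.update_of_ne (show i ≠ 4 by omega)],
          fun _ _ => rfl⟩
      exact ((hk₃.trans (hk₄.mono le_rfl (by omega) (by omega) le_rfl)).trans hdiv).trans
        (.setNat _ _ (by norm_num) (by norm_num))
    · simp only [Instr.exec, Memory.setReal, Memory.setNat, Function.update_self, h4₄, h6₄]
      rw [pow_succ, div_div]
    · rcases (Nat.lt_succ_iff.1 ht).lt_or_eq with h | rfl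
      · simpa [h.le, Nat.succ_le_of_lt h] using hσ t h
      · simpa using hp
    · show s₄.sol l = if m + 1 ≤ m then σ (m + 1) else s₄.sol l
      rw [if_neg (by omega)]
  rintro s₃ ⟨hk₃, -, σ, hσ0, hσ, hsol₃⟩
  refine (Runs.repeated (T := 6) (Inv := fun m s' => s'.nat = s₃.nat ∧
    s'.real 5 = s₃.real 5 ∧ (∀ S, S ≠ 0 → s'.set S = s₃.set S) ∧ O.feas (s'.set 0) ∧
    O.f (s₃.set 0) ≤ O.f (s'.set 0) ∧ ∀ j : Fin l, j < m → O.f (σ n j) ≤ O.f (s'.set 0))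
    ⟨rfl, rfl, fun _ _ => rfl, ?_, le_rfl, by simp⟩ ?_).post ?_
  · rw [hk₃.set 0 (by omega), hset0 0 (by omega)]
    exact hs0
  · rintro j hj s₄ ⟨hn₄, hr₄, hs₄, hf₄, hle₄, hall₄⟩
    have hj₄ : s₄.set (2 + j) = σ n ⟨j, hj⟩ := by
      rw [hs₄ _ (by omega), ← hsol₃, Memory.sol]
    refine (improve_runs s₄ (2 + j)).post fun s₅ ⟨hn₅, hr₅, hs₅, h0₅, hle₅, hle₅'⟩ =>
      ⟨hn₅.trans hn₄, (hr₅ 5 (by omega)).trans hr₄, fun S hS => (hs₅ S hS).trans (hs₄ S hS), ?_,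
        hle₄.trans hle₅, fun i hi => ?_⟩
    · rcases h0₅ with h | h <;> rw [h]
      · exact hf₄
      · rw [hj₄]
        exact (disjoint_and_feasible hempty hσ0 hσ).2 _
    · rcases (Nat.lt_succ_iff.1 hi).lt_or_eq with h1 | h1
      · exact (hall₄ i h1).trans hle₅
      · obtain rfl : i = ⟨j, hj⟩ := Fin.ext h1
        rwa [← hj₄]
  · rintro s₄ ⟨hn₄, hr₄, hs₄, hf₄, hle₄, hall₄⟩
    refine ⟨?_, ?_, hf₄, ?_, ?_, σ, ⟨hσ0, hσ⟩, fun j => hall₄ j j.2⟩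
    · rw [hn₄, hk₃.nat 0 (by omega), hn₂]
    · rw [hs₄ _ (by omega), hk₃.set _ (by omega), hset0 _ (by omega), hs]
    · rw [hr₄, hk₃.real 5 (by omega), h5]
    · rwa [hk₃.set 0 (by omega), hset0 0 (by omega)] at hle₄

/-- A bound for the number of steps of the algorithm. -/
def algorithmTime (l n : ℕ) : ℕ :=
  (n * 14 + 3) + ((localSearchTime l n + (localSearchTime l n + localSearchTime l n + 1) + 1) + 2)
    + 1

theorem bestSingleton_runs (hempty : O.feas ∅) (s : Memory n) (hn : s.nat 0 = n)
    (hs : ∀ S, s.set S = ∅) :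
    Runs O (.bestSingleton l) s (n * 14 + 3) fun s' => s'.nat 0 = n ∧ s'.set (2 + 2 * l) = ∅ ∧
      O.feas (s'.set 0) ∧ ∀ e, O.feas {e} → O.f {e} ≤ O.f (s'.set 0) := by
  refine (Runs.forLoop (T := 11) (Inv := fun m s' => s'.nat 0 = n ∧ s'.set (2 + 2 * l) = ∅ ∧
    O.feas (s'.set 0) ∧ ∀ e : Fin n, e < m → O.feas {e} → O.f {e} ≤ O.f (s'.set 0))
    (by norm_num) hn ⟨by simpa [Memory.setNat] using hn, hs _, by
      rw [show (s.setNat 2 0).set 0 = s.set 0 from rfl, hs]; exact hempty, by simp⟩ ?_).post ?_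
  · rintro m hm s₁ ⟨-, hs₁, hf₁, hle₁⟩ hi hn₁
    refine Runs.of_le (T := 11) (Runs.instr_seq (Runs.instr_seq ?_)) le_rfl
    generalize hs₂ : Instr.exec O _ (Instr.setInsert 1 2) = s₂
    obtain ⟨hnat, h1, hset⟩ : s₂.nat = s₁.nat ∧ s₂.set 1 = {⟨m, hm⟩} ∧
        ∀ S, S ≠ 1 → s₂.set S = s₁.set S := by
      subst hs₂
      refine ⟨?_, ?_, fun S hS => ?_⟩ <;>
      simp_all [Instr.exec, Memory.setSet]
    have h0 := hset 0 (by norm_num)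
    have hle₂ : ∀ s₃ : Memory n, O.f (s₂.set 0) ≤ O.f (s₃.set 0) →
        (O.feas {⟨m, hm⟩} → O.f {⟨m, hm⟩} ≤ O.f (s₃.set 0)) →
        ∀ e : Fin n, e < m + 1 → O.feas {e} → O.f {e} ≤ O.f (s₃.set 0) := by
      intro s₃ h h' e he hfe
      rcases (Nat.lt_succ_iff.1 he).lt_or_eq with h1 | h1
      · exact (hle₁ e h1 hfe).trans (h0 ▸ h)
      · obtain rfl : e = ⟨m, hm⟩ := Fin.ext h1
        exact h' hfe
    refine Runs.ite (T := 6) (fun h => ?_) fun h => (Runs.skip ?_).of_le (by norm_num)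
    all_goals simp only [Test.Holds, h1] at h
    · refine (improve_runs s₂ 1).post fun s₃ ⟨hn₃, _, hs₃, h0₃, hle₃, hle₃'⟩ => ?_
      have hn0 : s₃.nat 0 = n := by rw [hn₃, hnat, hn₁]
      refine ⟨by rw [hn₃, hnat, hi], hn0, by simpa [Memory.setNat] using hn0, ?_, ?_, ?_⟩
      · show s₃.set (2 + 2 * l) = ∅
        rw [hs₃ _ (by omega), hset _ (by omega), hs₁]
      · show O.feas (s₃.set 0)
        rcases h0₃ with h' | h'
        · rwa [h', h0]
        · rwa [h', h1]
      · exact hle₂ s₃ hle₃ fun _ => h1 ▸ hle₃'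
    · have hn0 : s₂.nat 0 = n := by rw [hnat, hn₁]
      refine ⟨by rw [hnat, hi], hn0, by simpa [Memory.setNat] using hn0, ?_, ?_, ?_⟩
      · show s₂.set (2 + 2 * l) = ∅
        rw [hset _ (by omega), hs₁]
      · show O.feas (s₂.set 0)
        rwa [h0]
      · exact hle₂ s₂ le_rfl fun h' => absurd h' h
  · rintro s' ⟨h1, h2, h3, h4⟩
    exact ⟨h1, h2, h3, fun e => h4 e e.2⟩

theorem algorithm_runs (hf : IsSubmodular O.f) (hempty : O.feas ∅) (k : ℕ) :
    Runs O (.algorithm l) (Memory.init n k) (algorithmTime l n) fun s' => O.feas s'.output ∧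
      ∃ W, W ≤ O.f s'.output ∧ (∀ e, O.feas {e} → O.f {e} ≤ W) ∧
        (∃ S, W = O.f S) ∧ ∃ σ₁ σ₂ σ₃ : ℕ → Fin l → Finset (Fin n),
        IsRun O.feas O.f W σ₁ ∧ IsRun O.feas O.f (5 / 4 * W) σ₂ ∧
        IsRun O.feas O.f (8 / 5 * W) σ₃ ∧ (∀ j, O.f (σ₁ n j) ≤ O.f s'.output) ∧
        (∀ j, O.f (σ₂ n j) ≤ O.f s'.output) ∧ ∀ j, O.f (σ₃ n j) ≤ O.f s'.output := by
  refine Runs.seq ((bestSingleton_runs (l := l) hempty _ (by simp [Memory.init])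
    fun _ => rfl).post fun s₁ ⟨hn₁, he₁, hf₁, hle₁⟩ => Runs.instr_seq ?_)
  generalize hs₂ : Instr.exec O s₁ (Instr.value 5 0) = s₂
  obtain ⟨hn₂, hset₂, hr₂⟩ : s₂.nat 0 = n ∧ s₂.set = s₁.set ∧ s₂.real 5 = O.f (s₁.set 0) := by
    subst hs₂
    exact ⟨hn₁, rfl, by simp [Instr.exec, Memory.setReal]⟩
  refine Runs.seq ((localSearch_runs hf hempty 1 1 s₂ hn₂ (by rw [hset₂, he₁])
    (by rwa [hset₂])).post fun s₃ ⟨hn₃, he₃, hf₃, hr₃, hle₃, σ₁, hσ₁, hF₁⟩ => Runs.seq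
    ((localSearch_runs hf hempty 5 4 s₃ hn₃ he₃ hf₃).post
    fun s₄ ⟨hn₄, he₄, hf₄, hr₄, hle₄, σ₂, hσ₂, hF₂⟩ =>
    (localSearch_runs hf hempty 8 5 s₄ hn₄ he₄ hf₄).post
    fun s₅ ⟨_, _, hf₅, _, hle₅, σ₃, hσ₃, hF₃⟩ => ?_))
  rw [hr₂] at hσ₁
  rw [hr₃, hr₂] at hσ₂
  rw [hr₄, hr₃, hr₂] at hσ₃
  rw [hset₂] at hle₃
  refine ⟨hf₅, O.f (s₁.set 0), (hle₃.trans hle₄).trans hle₅, hle₁, ⟨_, rfl⟩, σ₁, σ₂, σ₃,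
    by simpa using hσ₁, by simpa using hσ₂, by simpa using hσ₃,
    fun j => ((hF₁ j).trans hle₄).trans hle₅, fun j => (hF₂ j).trans hle₅, hF₃⟩

end Correctness

/-! ### The approximation guarantee -/

theorem exists_polynomial_time (l : ℕ) :
    ∃ q : Polynomial ℕ, ∀ n, q.eval n = algorithmTime l n := by
  let X : Polynomial ℕ := Polynomial.X
  let L : Polynomial ℕ := Polynomial.C l
  let pT := (X * (L * 13 + 4) + 3) + (X * (X * (X * (L * 21 + 4) + 6) + 6) + 3) + 1
  let phT := (L * 2 + 1) + ((X * (pT + 3) + 3) + pT + 1) + 1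
  let lT := (L * 2 + 1) + (((X * (phT + 2 + 3) + 3) + (L * 7 + 1) + 1) + 16) + 1
  refine ⟨(X * 14 + 3) + ((lT + (lT + lT + 1) + 1) + 2) + 1, fun n => ?_⟩
  simp [X, L, pT, phT, lT, algorithmTime, localSearchTime, phaseTime, passTime]

theorem theorem2 :
    ∃ (P : Prog) (time : Polynomial ℕ) (C : ℝ), 0 ≤ C ∧
      -- polynomial running time, feasibility of the output, and approximation ratio
      (∀ (n k : ℕ) (feas : Finset (Fin n) → Prop) (f : Finset (Fin n) → ℝ),
        1 ≤ k → IsMatroidParity k feas → (∀ S, 0 ≤ f S) → IsSubmodular f →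
          (P.runOn k feas f (time.eval n)).Always (fun s => feas s.output) ∧
          ∀ S : Finset (Fin n), feas S →
            ENNReal.ofReal (f S) ≤
              ENNReal.ofReal
                  (2 * k * Real.log 2 / (1 + Real.log 2) + C * (k : ℝ) ^ (2 / 3 : ℝ)) *
                (P.runOn k feas f (time.eval n)).expect
                  (fun s => ENNReal.ofReal (f s.output))) ∧
      -- the numerical bound on the leading term
      ∀ k : ℕ, 2 * k * Real.log 2 / (1 + Real.log 2) + C * (k : ℝ) ^ (2 / 3 : ℝ) ≤
        0.819 * k + C * (k : ℝ) ^ (2 / 3 : ℝ) := by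
  have hlog1 := Real.log_two_gt_d9
  have hlog2 := Real.log_two_lt_d9
  have hden : 0 < 1 + Real.log 2 := by linarith
  obtain ⟨time, htime⟩ := exists_polynomial_time 10000
  refine ⟨.algorithm 10000, time, 20000, by norm_num, ?_, fun k => ?_⟩
  · intro n k feas f hk hM hf0 hf
    have hempty : feas ∅ := by
      obtain ⟨V, M, v, -, -, -, h⟩ := hM
      exact (h ∅).2 (by simp)
    obtain ⟨s', ⟨hfeas, W, hWF, hW, ⟨S₀, rfl⟩, σ₁, σ₂, σ₃, h₁, h₂, h₃, hF₁, hF₂, hF₃⟩, hrun⟩ :=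
      (algorithm_runs (O := ⟨feas, f⟩) (l := 10000) hf hempty k).exists_done
    rw [htime, Prog.runOn, hrun]
    refine ⟨hfeas, fun S hS => ?_⟩
    rw [Outcome.expect, ← ENNReal.ofReal_mul (by positivity)]
    refine ENNReal.ofReal_le_ofReal ((approximation_ratio hM hf hf0 (hf0 S₀) hWF hW h₁ h₂ h₃ hF₁ hF₂
      hF₃ hS).trans (mul_le_mul_of_nonneg_right (add_le_add ?_ ?_) (hf0 _)))
    -- The constant 0.818 lies below `2 * Real.log 2 / (1 + Real.log 2)`, which is about 0.8188.
    · rw [le_div_iff₀ hden]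
      have := mul_le_mul_of_nonneg_left (show (0.818 : ℝ) * (1 + Real.log 2) ≤ 2 * Real.log 2 by
        linarith) (Nat.cast_nonneg (α := ℝ) k)
      linarith
    -- The additive error is a constant, so `1 ≤ k` is enough to absorb it into the lower-order
    -- term.
    · have : (1 : ℝ) ≤ (k : ℝ) ^ (2 / 3 : ℝ) :=
        Real.one_le_rpow (by exact_mod_cast hk) (by norm_num)
      linarith
  · gcongr
    rw [div_le_iff₀ hden]
    have := mul_le_mul_of_nonneg_left (show 2 * Real.log 2 ≤ (0.819 : ℝ) * (1 + Real.log 2) by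
      linarith) (Nat.cast_nonneg (α := ℝ) k)
    linarith
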